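/- Let $k$ be a commutative artinian ring and $R$ an artin $k$-algebra (a $k$-algebra that is finitely generated as a $k$-module). Let $\mathrm{mod}\,R$ be the category of finitely generated left $R$-modules, $\mathcal D=\mathcal D^b(\mathrm{mod}\,R)$ its bounded derived category, and $D=\mathrm{Hom}_k(-,E)$ the usual duality between $\mathrm{mod}\,R$ and $\mathrm{mod}\,R^{op}$, where $E$ is the injective envelope of $k/\mathrm{rad}\,k$; the induced duality $\mathcal D^b(\mathrm{mod}\,R)\to\mathcal D^b(\mathrm{mod}\,R^{op})$ is also denoted by $D$. Modules are regarded as stalk complexes in degree $0$. For $T\in\mathcal D$ use the following notation (likewise over $R^{op}$). * $T$ is semi-selforthogonal if $\mathrm{Hom}_{\mathcal D}(T,T[i])=0$ for all $i>0$. $\mathrm{add}_{\mathcal D}T$ is the class of direct summands of finite direct sums of copies of $T$. $T^{\perp_{>0}}$ (resp. ${}^{\perp_{>0}}T$) is the class of all $N\in\mathcal D$ with $\mathrm{Hom}_{\mathcal D}(T,N[i])=0$ (resp. $\mathrm{Hom}_{\mathcal D}(N,T[i])=0$) for all $i>0$. For a finite interval $I$ of integers, $\mathcal D^I$ is the class of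 complexes with cohomology concentrated in $I$. * The Auslander class ${}_T\mathcal X^\flat$ consists of all $X\in\mathcal D$ for which there are a finite interval $I$ with $T\in\mathcal D^I$ and triangles $X_{i+1}\to T_i\to X_i\to X_{i+1}[1]$ ($i\ge 0$) with $X_0=X$, all $T_i\in\mathrm{add}_{\mathcal D}T$ and all $X_i\in T^{\perp_{>0}}\cap\mathcal D^I$. * The co-Auslander class $\mathcal X_T^\flat$ consists of all $X\in\mathcal D$ for which there are a finite interval $I$ with $T\in\mathcal D^I$ and triangles $X_i\to T_i\to X_{i+1}\to X_i[1]$ ($i\ge 0$) with $X_0=X$, all $T_i\in\mathrm{add}_{\mathcal D}T$ and all $X_i\in{}^{\perp_{>0}}T\cap\mathcal D^I$. * For a class $\mathcal C$ of objects, $\langle\mathcal C\rangle_+$ (resp. $\langle\mathcal C\rangle_-$) is the class of objects isomorphic to $C[n]$ with $C\in\mathcal C$ and $n\ge 0$ (resp. $n\le 0$). * $T$ is Wakamatsu-silting if it is semi-selforthogonal and $R\in\langle\mathcal X_T^\flat\rangle_+$. Then for every $T\in\mathcal D^b(\mathrm{mod}\,R)$ the following are equivalent: 1. $T$ is Wakamatsu-silting;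 2. $T$ is semi-selforthogonal and $DR\in\langle{}_T\mathcal X^\flat\rangle_-$, where $DR$ is the left $R$-module dual to the right module $R_R$; 3. $DT\in\mathcal D^b(\mathrm{mod}\,R^{op})$ is Wakamatsu-silting. -/

import Mathlib

open CategoryTheory

universe u v u' v' w w'

namespace WakamatsuSilting

noncomputable section

/-- `i : M → E` is an injective envelope: a monomorphism into an injective module whose image
meets every nonzero submodule of `E` nontrivially. -/
structure IsInjectiveEnvelope {A : Type u} [Ring A] {M E : Type u} [AddCommGroup M] [Module A M]
    [AddCommGroup E] [Module A E] (i : M →ₗ[A] E) : Prop where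
  injective : Function.Injective i
  injective_module : Module.Injective A E
  essential : ∀ N : Submodule A E, N ⊓ LinearMap.range i = ⊥ → N = ⊥

/-- Every module has an injective envelope. -/
theorem exists_isInjectiveEnvelope (A : Type u) [Ring A] (M : Type u) [AddCommGroup M]
    [Module A M] : ∃ (E : ModuleCat.{u} A) (i : M →ₗ[A] E), IsInjectiveEnvelope i := by
  obtain ⟨I, hI, j, hj⟩ : ∃ (I : ModuleCat.{u} A) (_ : Module.Injective A I) (j : M →ₗ[A] I),
      Function.Injective j := by
    refine ⟨Injective.under (ModuleCat.of A M), ?_, (Injective.ι (ModuleCat.of A M)).hom, ?_⟩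
    · exact (Module.injective_iff_injective_object A _).2
        (inferInstanceAs (Injective (Injective.under (ModuleCat.of A M))))
    · exact (ModuleCat.mono_iff_injective _).1 inferInstance
  let N₀ : Submodule A I := LinearMap.range j
  let S : Set (Submodule A I) := {N | N₀ ≤ N ∧ ∀ P ≤ N, P ⊓ N₀ = ⊥ → P = ⊥}
  obtain ⟨N, hN₀, hN⟩ : ∃ N, N₀ ≤ N ∧ Maximal (· ∈ S) N := by
    refine zorn_le_nonempty₀ S (fun c hcS hc N hNc => ⟨sSup c, ⟨?_, ?_⟩, fun z => le_sSup⟩) N₀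
      ⟨le_rfl, fun P hP h => by rwa [inf_eq_left.2 hP] at h⟩
    · exact (hcS hNc).1.trans (le_sSup hNc)
    · intro P hP hPN
      rw [Submodule.eq_bot_iff]
      intro x hx
      obtain ⟨N', hN', hxN'⟩ := (Submodule.mem_sSup_of_directed ⟨N, hNc⟩ hc.directedOn).1 (hP hx)
      have := (hcS hN').2 (Submodule.span A {x}) (by simpa using hxN')
        (eq_bot_iff.2 ((inf_le_inf_right N₀ (by simpa using hx)).trans hPN.le))
      simpa using this
  obtain ⟨C, -, hC⟩ : ∃ C, ⊥ ≤ C ∧ Maximal (· ∈ {C : Submodule A I | C ⊓ N = ⊥}) C := by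
    refine zorn_le_nonempty₀ _ (fun c hcS hc C hCc => ⟨sSup c, ?_, fun z => le_sSup⟩) ⊥ (by simp)
    refine (Submodule.eq_bot_iff _).2 ?_
    rintro x ⟨hx, hxN⟩
    obtain ⟨C', hC', hxC'⟩ := (Submodule.mem_sSup_of_directed ⟨C, hCc⟩ hc.directedOn).1 hx
    have : x ∈ C' ⊓ N := ⟨hxC', hxN⟩
    rw [show C' ⊓ N = ⊥ from hcS hC'] at this
    simpa using this
  have hinj : Function.Injective (C.mkQ ∘ₗ N.subtype) := by
    rw [← LinearMap.ker_eq_bot, LinearMap.ker_eq_bot']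
    rintro ⟨x, hx⟩ h
    have h' : x ∈ C ⊓ N := ⟨by simpa using h, hx⟩
    rw [show C ⊓ N = ⊥ from hC.1] at h'
    simpa using h'
  obtain ⟨h, hh⟩ := hI.out (C.mkQ ∘ₗ N.subtype) hinj N.subtype
  have key : ∀ P : Submodule A (I ⧸ C), (∀ x ∈ N, C.mkQ x ∈ P → x = 0) → P = ⊥ := by
    intro P hP
    have hle : C ≤ P.comap C.mkQ := fun x hx => by
      have : C.mkQ x = 0 := by simpa using hx
      simp only [Submodule.mem_comap, this, P.zero_mem]
    have hmem : P.comap C.mkQ ⊓ N = ⊥ := by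
      rw [Submodule.eq_bot_iff]
      exact fun x hx => hP x hx.2 hx.1
    have hge := hC.2 hmem hle
    rw [Submodule.eq_bot_iff]
    intro y hy
    obtain ⟨x, rfl⟩ := C.mkQ_surjective y
    simpa using hge hy
  have hrange : LinearMap.range h ∈ S := by
    refine ⟨fun x hx => ⟨C.mkQ x, hh ⟨x, hN.1.1 hx⟩⟩, fun P hP hPN => ?_⟩
    have h1 : P ⊓ N = ⊥ := hN.1.2 _ inf_le_right
      (eq_bot_iff.2 ((inf_le_inf_right N₀ inf_le_left).trans hPN.le))
    have h2 : P.comap h = ⊥ := key _ fun x hx hxP => by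
      have : x ∈ P ⊓ N := ⟨(show h (C.mkQ x) = x from hh ⟨x, hx⟩) ▸ hxP, hx⟩
      rw [h1] at this
      simpa using this
    rw [Submodule.eq_bot_iff]
    intro x hx
    obtain ⟨y, rfl⟩ := hP hx
    have : y ∈ P.comap h := hx
    rw [h2] at this
    simp [(Submodule.mem_bot A).1 this]
  have hle : LinearMap.range h ≤ N :=
    hN.2 hrange fun x hx => ⟨C.mkQ x, hh ⟨x, hx⟩⟩
  let r : I →ₗ[A] N := LinearMap.codRestrict N (h ∘ₗ C.mkQ) fun x => hle ⟨_, rfl⟩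
  have hr : ∀ x : N, r x = x := fun x => Subtype.ext (hh x)
  refine ⟨ModuleCat.of A N, LinearMap.codRestrict N j fun x => hN₀ ⟨x, rfl⟩, ?_, ⟨?_⟩, ?_⟩
  · exact fun x y hxy => hj (congrArg Subtype.val hxy)
  · intro X Y _ _ _ _ f hf g
    obtain ⟨g', hg'⟩ := hI.out f hf (N.subtype ∘ₗ g)
    refine ⟨r ∘ₗ g', fun x => ?_⟩
    simp only [LinearMap.comp_apply, hg']
    exact hr (g x)
  · intro P hP
    have : P.map N.subtype = ⊥ := by
      refine hN.1.2 _ (Submodule.map_subtype_le N P) ?_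
      rw [Submodule.eq_bot_iff]
      rintro _ ⟨⟨x, hx, rfl⟩, ⟨m, hm⟩⟩
      have hx' : x ∈ P ⊓ LinearMap.range
          (LinearMap.codRestrict N j fun x => hN₀ ⟨x, rfl⟩) := ⟨hx, m, Subtype.ext hm⟩
      rw [hP] at hx'
      simp [(Submodule.mem_bot A).1 hx']
    exact Submodule.map_injective_of_injective N.subtype_injective (this.trans (Submodule.map_bot _).symm)

/-- If `E` is an injective envelope of a finitely generated module over a commutative artinian
ring `k`, then `Hom_k(N, E)` is finitely generated for every finitely generated `N`. -/
theorem IsInjectiveEnvelope.finite_hom {k : Type u} [CommRing k] [IsArtinianRing k]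
    {M E : Type u} [AddCommGroup M] [Module k M] [Module.Finite k M]
    [AddCommGroup E] [Module k E] {i : M →ₗ[k] E} (hi : IsInjectiveEnvelope i)
    (N : Type u) [AddCommGroup N] [Module k N] [Module.Finite k N] :
    Module.Finite k (N →ₗ[k] E) := by
  induction ‹Module.Finite k N› using
    IsNoetherianRing.induction_on_isQuotientEquivQuotientPrime k with
  | subsingleton N =>
    have : Subsingleton (N →ₗ[k] E) := ⟨fun f g => by
      ext x
      rw [Subsingleton.elim x 0, map_zero, map_zero]⟩
    infer_instance
  | quotient N p e =>
    have hmax : p.1.IsMaximal := inferInstance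
    have : IsSimpleModule k (k ⧸ p.1) := isSimpleModule_iff_isCoatom.2 hmax.out
    have : IsSimpleModule k N := IsSimpleModule.congr e
    have hle : ∀ (f : N →ₗ[k] E) (x : N), f x ∈ LinearMap.range i := by
      intro f x
      by_contra hx
      have h1 : (LinearMap.range i).comap f = ⊥ :=
        (eq_bot_or_eq_top _).resolve_right fun h => hx (by
          have : x ∈ (LinearMap.range i).comap f := h ▸ Submodule.mem_top
          exact this)
      have h2 := hi.essential (LinearMap.range f) (by
        rw [Submodule.eq_bot_iff]
        rintro _ ⟨⟨y, rfl⟩, hy⟩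
        have : y ∈ (LinearMap.range i).comap f := hy
        rw [h1] at this
        simp [(Submodule.mem_bot k).1 this])
      rw [LinearMap.range_eq_bot] at h2
      exact hx (by simp [h2])
    have hgen : ∀ x : N, ∃ c : k, x = c • e.symm 1 := fun x => by
      obtain ⟨c, hc⟩ := Ideal.Quotient.mk_surjective (e x)
      refine ⟨c, e.injective ?_⟩
      rw [map_smul, e.apply_symm_apply, ← hc, Algebra.smul_def, mul_one]
      rfl
    let ev : (N →ₗ[k] E) →ₗ[k] LinearMap.range i :=
      LinearMap.codRestrict _ (LinearMap.applyₗ (e.symm 1)) fun f => hle f _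
    refine Module.Finite.of_injective ev fun f g hfg => ?_
    ext x
    obtain ⟨c, rfl⟩ := hgen x
    rw [map_smul, map_smul]
    exact congrArg _ (congrArg Subtype.val hfg)
  | exact N₁ N₂ N₃ f g hf hg hfg h₁ h₃ =>
    have := isNoetherian_of_isNoetherianRing_of_finite k (N₁ →ₗ[k] E)
    have := isNoetherian_of_isNoetherianRing_of_finite k (N₃ →ₗ[k] E)
    have := isNoetherian_of_range_eq_ker (LinearMap.lcomp k E g) (LinearMap.lcomp k E f) (by
      ext φ
      exact (LinearMap.exact_lcomp_of_exact_of_surjective E hfg hg φ).symm)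
    infer_instance

/-- `R` is an artin algebra over `k`: the commutative ring `k` is artinian and the `k`-algebra `R`
is finitely generated as a `k`-module. (`outParam` only helps instance search to find `k`.) -/
class IsArtinAlgebra (k : outParam (Type u)) (R : Type u) [CommRing k] [Ring R] [Algebra k R] :
    Prop where
  isArtinianRing : IsArtinianRing k
  finite : Module.Finite k R

section
variable (k R : Type u) [CommRing k] [Ring R] [Algebra k R] [IsArtinAlgebra k R]

instance IsArtinAlgebra.isNoetherianRing : IsNoetherianRing R :=
  haveI := IsArtinAlgebra.isArtinianRing (k := k) (R := R)
  haveI := IsArtinAlgebra.finite (k := k) (R := R)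
  IsNoetherianRing.of_finite k R

instance IsArtinAlgebra.mulOpposite : IsArtinAlgebra k Rᵐᵒᵖ where
  isArtinianRing := IsArtinAlgebra.isArtinianRing (k := k) (R := R)
  finite :=
    haveI := IsArtinAlgebra.finite (k := k) (R := R)
    Module.Finite.equiv (MulOpposite.opLinearEquiv k)
end

/-- The injective envelope `E` of the `k`-module `k / rad k`. -/
def dualizingModule (k : Type u) [CommRing k] : ModuleCat.{u} k :=
  (exists_isInjectiveEnvelope k (k ⧸ Ring.jacobson k)).choose

theorem dualizingModule_spec (k : Type u) [CommRing k] :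
    ∃ i : (k ⧸ Ring.jacobson k) →ₗ[k] dualizingModule k, IsInjectiveEnvelope i :=
  (exists_isInjectiveEnvelope k (k ⧸ Ring.jacobson k)).choose_spec

section Dual

variable {k R S : Type u} [CommRing k] [Ring R] [Algebra k R] [Ring S] [Algebra k S]
  (σ : S ≃ₐ[k] Rᵐᵒᵖ)

/-- The dual `D M = Hom_k(M, E)` of a left `R`-module `M`, for the underlying `k`-module of `M`.
It is a right `R`-module by `(f r) x = f (r x)`, that is, a left module over any algebra `S` which
is identified with the opposite algebra of `R` by `σ`. -/
def DualModule (_σ : S ≃ₐ[k] Rᵐᵒᵖ) (M : Type u) [AddCommGroup M] [Module R M] : Type u :=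
  RestrictScalars k R M →ₗ[k] dualizingModule k

namespace DualModule

section

variable (M : Type u) [AddCommGroup M] [Module R M]

instance : AddCommGroup (DualModule σ M) :=
  inferInstanceAs (AddCommGroup (RestrictScalars k R M →ₗ[k] dualizingModule k))

instance : Module k (DualModule σ M) :=
  inferInstanceAs (Module k (RestrictScalars k R M →ₗ[k] dualizingModule k))

end

variable {M N : Type u} [AddCommGroup M] [Module R M] [AddCommGroup N] [Module R N]

variable {σ} in
/-- The linear map underlying an element of the dual. -/
def toLin (f : DualModule σ M) : RestrictScalars k R M →ₗ[k] dualizingModule k := f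

instance : FunLike (DualModule σ M) M (dualizingModule k) where
  coe f x := f.toLin x
  coe_injective _ _ h := LinearMap.ext (congrFun h)

theorem ext {f g : DualModule σ M} (h : ∀ x, f x = g x) : f = g := DFunLike.ext _ _ h

instance : AddMonoidHomClass (DualModule σ M) M (dualizingModule k) where
  map_add f := f.toLin.map_add
  map_zero f := f.toLin.map_zero

theorem map_algebraMap_smul (f : DualModule σ M) (c : k) (x : M) :
    f (algebraMap k R c • x) = c • f x :=
  f.toLin.map_smul c x

instance : SMul S (DualModule σ M) where
  smul s f := f.toLin ∘ₗ RestrictScalars.lsmul k R M (σ s).unop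

theorem smul_apply (s : S) (f : DualModule σ M) (x : M) : (s • f) x = f ((σ s).unop • x) :=
  rfl

instance : Module S (DualModule σ M) where
  one_smul f := ext σ fun x => by
    rw [smul_apply, map_one, MulOpposite.unop_one, one_smul]
  mul_smul s t f := ext σ fun x => by
    rw [smul_apply, smul_apply, smul_apply, map_mul, MulOpposite.unop_mul, mul_smul]
  smul_zero _ := rfl
  smul_add _ _ _ := rfl
  add_smul s t f := ext σ fun x => by
    rw [smul_apply, map_add, MulOpposite.unop_add, add_smul, map_add]
    rfl
  zero_smul f := ext σ fun x => by
    rw [smul_apply, map_zero, MulOpposite.unop_zero, zero_smul, map_zero]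
    rfl

instance : IsScalarTower k S (DualModule σ M) where
  smul_assoc c s f := ext σ fun x => by
    change f ((σ (c • s)).unop • x) = c • f ((σ s).unop • x)
    rw [map_smul σ, MulOpposite.unop_smul, Algebra.smul_def, mul_smul, map_algebraMap_smul]

instance [IsArtinAlgebra k R] [Module.Finite R M] : Module.Finite S (DualModule σ M) := by
  have := IsArtinAlgebra.isArtinianRing (k := k) (R := R)
  have := IsArtinAlgebra.finite (k := k) (R := R)
  let _ : Module k M := Module.restrictScalars k R M
  have : IsScalarTower k R M := IsScalarTower.restrictScalars k R M
  have : Module.Finite k M := Module.Finite.trans R M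
  obtain ⟨i, hi⟩ := dualizingModule_spec k
  have : Module.Finite k (DualModule σ M) := hi.finite_hom M
  exact Module.Finite.of_restrictScalars_finite k S _

/-- The map `f ↦ f ∘ φ`. -/
def map (φ : M →ₗ[R] N) : DualModule σ N →ₗ[S] DualModule σ M where
  toFun f := f.toLin ∘ₗ (show RestrictScalars k R M →ₗ[k] RestrictScalars k R N from
    { toFun := φ
      map_add' := φ.map_add
      map_smul' := fun c x => φ.map_smul (algebraMap k R c) x })
  map_add' _ _ := rfl
  map_smul' _ f := ext σ fun x => congrArg f (φ.map_smul _ x).symm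

theorem map_apply (φ : M →ₗ[R] N) (f : DualModule σ N) (x : M) : map σ φ f x = f (φ x) := rfl

/-- The dual of an exact sequence is exact, by injectivity of the dualizing module. -/
theorem exists_map_eq {P : Type u} [AddCommGroup P] [Module R P] (φ : M →ₗ[R] N) (ψ : N →ₗ[R] P)
    (h : ∀ x, ψ x = 0 → ∃ y, φ y = x) (f : DualModule σ N) (hf : map σ φ f = 0) :
    ∃ g : DualModule σ P, map σ ψ g = f := by
  let _ : Module k N := Module.restrictScalars k R N
  let _ : Module k P := Module.restrictScalars k R P
  let ψ' : N →ₗ[k] P :=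
    { toFun := ψ
      map_add' := ψ.map_add
      map_smul' := fun c x => ψ.map_smul (algebraMap k R c) x }
  let f' : N →ₗ[k] dualizingModule k := f
  have hker : LinearMap.ker ψ' ≤ LinearMap.ker f' := fun x hx => by
    obtain ⟨y, rfl⟩ := h x hx
    exact DFunLike.congr_fun hf y
  obtain ⟨i, hi⟩ := dualizingModule_spec k
  obtain ⟨g, hg⟩ := hi.injective_module.out (LinearMap.range ψ').subtype
    (Submodule.subtype_injective _)
    ((LinearMap.ker ψ').liftQ f' hker ∘ₗ ψ'.quotKerEquivRange.symm.toLinearMap)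
  refine ⟨g, ext σ fun x => (hg ⟨ψ' x, x, rfl⟩).trans ?_⟩
  have : ψ'.quotKerEquivRange.symm ⟨ψ' x, x, rfl⟩ = (LinearMap.ker ψ').mkQ x := by
    rw [LinearEquiv.symm_apply_eq]
    rfl
  rw [LinearMap.comp_apply, LinearEquiv.coe_coe, this]
  rfl

end DualModule

open Opposite

/-- The usual duality `D = Hom_k(-, E)` from finitely generated left `R`-modules to finitely
generated left modules over the opposite algebra `S` of `R`. -/
@[simps]
def dualFunctor [IsArtinAlgebra k R] : (FGModuleCat.{u} R)ᵒᵖ ⥤ FGModuleCat.{u} S where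
  obj M := FGModuleCat.of S (DualModule σ M.unop)
  map f := FGModuleCat.ofHom (DualModule.map σ f.unop.hom.hom)

instance [IsArtinAlgebra k R] : (dualFunctor σ).Additive where
  map_add {M N f g} := by
    ext φ
    exact DualModule.ext σ fun x => map_add (show DualModule σ M.unop from φ) _ _

theorem exact_fgModuleCat_iff {A : Type u} [Ring A] [IsNoetherianRing A]
    (X : ShortComplex (FGModuleCat.{u} A)) :
    X.Exact ↔ ∀ x, X.g.hom.hom x = 0 → ∃ y, X.f.hom.hom y = x := by
  rw [← ShortComplex.exact_map_iff_of_faithful X (forget₂ (FGModuleCat.{u} A) (ModuleCat.{u} A)),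
    ShortComplex.moduleCat_exact_iff]
  rfl

instance [IsArtinAlgebra k R] [IsNoetherianRing S] : (dualFunctor σ).PreservesHomology := by
  refine Functor.preservesHomology_of_map_exact _ fun X hX => ?_
  rw [← ShortComplex.exact_unop_iff, exact_fgModuleCat_iff] at hX
  rw [exact_fgModuleCat_iff]
  exact fun φ hφ => DualModule.exists_map_eq σ X.unop.f.hom.hom X.unop.g.hom.hom hX φ hφ

end Dual

section Derived

open Opposite Limits

variable {C : Type u} [Category.{v} C] [Abelian C] {C' : Type u'} [Category.{v'} C'] [Abelian C']

theorem quasiIso_opEquivalence_map {K L : CochainComplex C ℤ} (f : K ⟶ L)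
    [hf : QuasiIso f] : QuasiIso ((CochainComplex.opEquivalence C).functor.map f.op) := by
  rw [quasiIso_iff] at hf ⊢
  intro n
  have h := hf (-n)
  rw [quasiIsoAt_iff' _ (-(n + 1)) (-n) (-(n - 1)) (by simp; lia) (by simp; lia)] at h
  rw [quasiIsoAt_iff' _ (n - 1) n (n + 1) (by simp) (by simp)]
  exact (ShortComplex.quasiIso_opMap_iff _).2 h

section

variable (F : Cᵒᵖ ⥤ C') [F.Additive]

/-- A contravariant functor `F` applied to complexes: the term of degree `n` is `F (K⁻ⁿ)`. -/
def contraMapComplex : (CochainComplex C ℤ)ᵒᵖ ⥤ CochainComplex C' ℤ :=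
  (CochainComplex.opEquivalence C).functor ⋙ F.mapHomologicalComplex (ComplexShape.up ℤ)

variable [F.PreservesHomology] [HasDerivedCategory.{w'} C']

theorem contraMapComplex_isInvertedBy :
    (HomologicalComplex.quasiIso C (ComplexShape.up ℤ)).op.IsInvertedBy
      (contraMapComplex F ⋙ DerivedCategory.Q) := by
  intro K L f (hf : QuasiIso f.unop)
  have : QuasiIso ((CochainComplex.opEquivalence C).functor.map f) :=
    quasiIso_opEquivalence_map f.unop
  have : QuasiIso ((contraMapComplex F).map f) :=
    HomologicalComplex.quasiIso_map_of_preservesHomology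
      ((CochainComplex.opEquivalence C).functor.map f) F
  exact inferInstanceAs (IsIso (DerivedCategory.Q.map ((contraMapComplex F).map f)))

variable [HasDerivedCategory.{w} C]

/-- The functor on derived categories induced by an exact contravariant functor. -/
def contraMapDerived : (DerivedCategory C)ᵒᵖ ⥤ DerivedCategory C' :=
  Localization.lift (contraMapComplex F ⋙ DerivedCategory.Q)
    (contraMapComplex_isInvertedBy F) DerivedCategory.Q.op

/-- The functor on derived categories is induced by the functor on complexes. -/
def contraMapDerivedFactors :
    DerivedCategory.Q.op ⋙ contraMapDerived F ≅ contraMapComplex F ⋙ DerivedCategory.Q :=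
  Localization.fac _ (contraMapComplex_isInvertedBy F) DerivedCategory.Q.op

/-- The functor on bounded derived categories induced by an exact contravariant functor. -/
def contraMapBounded :
    (DerivedCategory.Bounded C)ᵒᵖ ⥤ DerivedCategory.Bounded C' :=
  ObjectProperty.lift _ (DerivedCategory.Bounded.ι.op ⋙ contraMapDerived F) (by
    rintro ⟨X, ⟨a, ha⟩, ⟨b, hb⟩⟩
    obtain ⟨K, _, _, ⟨e⟩⟩ := DerivedCategory.exists_iso_Q_obj_of_isGE_of_isLE X a b
    let e' : (contraMapDerived F).obj (op X) ≅ 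
        DerivedCategory.Q.obj ((contraMapComplex F).obj (op K)) :=
      (contraMapDerived F).mapIso e.symm.op ≪≫ (contraMapDerivedFactors F).app (op K)
    have hz : ∀ n : ℤ, IsZero (K.X (-n)) → IsZero (((contraMapComplex F).obj (op K)).X n) :=
      fun n h => F.map_isZero h.op
    have h₁ : ((contraMapComplex F).obj (op K)).IsStrictlyGE (-b) := by
      rw [CochainComplex.isStrictlyGE_iff]
      exact fun n hn => hz n (K.isZero_of_isStrictlyLE b (-n) (by lia))
    have h₂ : ((contraMapComplex F).obj (op K)).IsStrictlyLE (-a) := by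
      rw [CochainComplex.isStrictlyLE_iff]
      exact fun n hn => hz n (K.isZero_of_isStrictlyGE a (-n) (by lia))
    exact ⟨⟨-b, ⟨_, e', h₁⟩⟩, ⟨-a, ⟨_, e', h₂⟩⟩⟩)

end

variable [HasDerivedCategory.{w} C]

/-- An object of `C` as a stalk complex in degree `0`. -/
def stalk (X : C) : DerivedCategory.Bounded C :=
  ⟨(DerivedCategory.singleFunctor C 0).obj X,
    ⟨0, inferInstanceAs (((DerivedCategory.singleFunctor C 0).obj X).IsGE 0)⟩,
    ⟨0, inferInstanceAs (((DerivedCategory.singleFunctor C 0).obj X).IsLE 0)⟩⟩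

/-- The complexes whose cohomology is concentrated in the interval `[a, b]`. -/
def cohomologyIn (a b : ℤ) : ObjectProperty (DerivedCategory.Bounded C) := fun X =>
  ∀ n : ℤ, n ∉ Set.Icc a b → IsZero ((DerivedCategory.homologyFunctor C n).obj X.obj)

/-- The complexes `N` with `Hom(M, N[i]) = 0` for all `i > 0`. -/
def rightPerp (M : DerivedCategory.Bounded C) : ObjectProperty (DerivedCategory.Bounded C) :=
  fun N => ∀ i : ℤ, 0 < i → ∀ f : M ⟶ N⟦i⟧, f = 0

/-- The complexes `N` with `Hom(N, M[i]) = 0` for all `i > 0`. -/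
def leftPerp (M : DerivedCategory.Bounded C) : ObjectProperty (DerivedCategory.Bounded C) :=
  fun N => ∀ i : ℤ, 0 < i → ∀ f : N ⟶ M⟦i⟧, f = 0

/-- `Hom(M, M[i]) = 0` for all `i > 0`. -/
def IsSemiSelforthogonal (M : DerivedCategory.Bounded C) : Prop := rightPerp M M

/-- The direct summands of finite direct sums of copies of `M`. -/
def addClosure (M : DerivedCategory.Bounded C) : ObjectProperty (DerivedCategory.Bounded C) :=
  fun N => ∃ (n : ℕ) (N' : DerivedCategory.Bounded C), Nonempty (N ⊞ N' ≅ ⨁ fun _ : Fin n => M)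

/-- There is a distinguished triangle `X ⟶ Y ⟶ Z ⟶ X[1]`. -/
def HasTriangle (X Y Z : DerivedCategory.Bounded C) : Prop :=
  ∃ (f : X ⟶ Y) (g : Y ⟶ Z) (h : Z ⟶ X⟦(1 : ℤ)⟧),
    Pretriangulated.Triangle.mk f g h ∈ Pretriangulated.distinguishedTriangles

/-- The class `_M 𝒳^I` for `I = [a, b]`: there are triangles `X_{i+1} ⟶ M_i ⟶ X_i ⟶` for all
`i ≥ 0` with `X_0 = X`, all `M_i` in `add M`, and all `X_i` right orthogonal to `M` with cohomology
in `I`. -/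
def auslanderClassOn (M : DerivedCategory.Bounded C) (a b : ℤ) :
    ObjectProperty (DerivedCategory.Bounded C) := fun X =>
  ∃ Y N : ℕ → DerivedCategory.Bounded C, Y 0 = X ∧ ∀ i : ℕ,
    HasTriangle (Y (i + 1)) (N i) (Y i) ∧ addClosure M (N i) ∧ rightPerp M (Y i) ∧
      cohomologyIn a b (Y i)

/-- The class `𝒳_M^I` for `I = [a, b]`: there are triangles `X_i ⟶ M_i ⟶ X_{i+1} ⟶` for all
`i ≥ 0` with `X_0 = X`, all `M_i` in `add M`, and all `X_i` left orthogonal to `M` with cohomology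
in `I`. -/
def coAuslanderClassOn (M : DerivedCategory.Bounded C) (a b : ℤ) :
    ObjectProperty (DerivedCategory.Bounded C) := fun X =>
  ∃ Y N : ℕ → DerivedCategory.Bounded C, Y 0 = X ∧ ∀ i : ℕ,
    HasTriangle (Y i) (N i) (Y (i + 1)) ∧ addClosure M (N i) ∧ leftPerp M (Y i) ∧
      cohomologyIn a b (Y i)

/-- The Auslander class `_M 𝒳^♭`. -/
def auslanderClass (M : DerivedCategory.Bounded C) :
    ObjectProperty (DerivedCategory.Bounded C) := fun X =>
  ∃ a b : ℤ, cohomologyIn a b M ∧ auslanderClassOn M a b X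

/-- The co-Auslander class `𝒳_M^♭`. -/
def coAuslanderClass (M : DerivedCategory.Bounded C) :
    ObjectProperty (DerivedCategory.Bounded C) := fun X =>
  ∃ a b : ℤ, cohomologyIn a b M ∧ coAuslanderClassOn M a b X

/-- `⟨P⟩_+`: the complexes isomorphic to `Z[n]` with `Z` in `P` and `n ≥ 0`. -/
def nonnegShifts (P : ObjectProperty (DerivedCategory.Bounded C)) :
    ObjectProperty (DerivedCategory.Bounded C) := fun X =>
  ∃ (n : ℤ) (Z : DerivedCategory.Bounded C), 0 ≤ n ∧ P Z ∧ Nonempty (X ≅ Z⟦n⟧)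

/-- `⟨P⟩_-`: the complexes isomorphic to `Z[n]` with `Z` in `P` and `n ≤ 0`. -/
def nonposShifts (P : ObjectProperty (DerivedCategory.Bounded C)) :
    ObjectProperty (DerivedCategory.Bounded C) := fun X =>
  ∃ (n : ℤ) (Z : DerivedCategory.Bounded C), n ≤ 0 ∧ P Z ∧ Nonempty (X ≅ Z⟦n⟧)

end Derived

section Silting

open Opposite

/-- `T` in `D^b(mod R)` is Wakamatsu-silting: it is semi-selforthogonal and the left regular module
`R` lies in `⟨𝒳_T^♭⟩_+`. -/
def IsWakamatsuSilting (R : Type u) [Ring R] [IsNoetherianRing R]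
    [HasDerivedCategory.{w} (FGModuleCat.{u} R)]
    (T : DerivedCategory.Bounded (FGModuleCat.{u} R)) : Prop :=
  IsSemiSelforthogonal T ∧ nonnegShifts (coAuslanderClass T) (stalk (FGModuleCat.of R R))

variable (k R : Type u) [CommRing k] [Ring R] [Algebra k R] [IsArtinAlgebra k R]

/-- The left `R`-module `DR`: the dual of the right regular module `R`, that is, of the left
regular module of the opposite algebra. -/
def dualRegular : FGModuleCat.{u} R :=
  (dualFunctor (AlgEquiv.opOp k R)).obj (op (FGModuleCat.of Rᵐᵒᵖ Rᵐᵒᵖ))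

/-- The duality `D : D^b(mod R) ⥤ D^b(mod Rᵒᵖ)`, contravariant, induced by `D = Hom_k(-, E)`. -/
def derivedDual [HasDerivedCategory.{w} (FGModuleCat.{u} R)]
    [HasDerivedCategory.{w'} (FGModuleCat.{u} Rᵐᵒᵖ)] :
    (DerivedCategory.Bounded (FGModuleCat.{u} R))ᵒᵖ ⥤
      DerivedCategory.Bounded (FGModuleCat.{u} Rᵐᵒᵖ) :=
  contraMapBounded (dualFunctor (AlgEquiv.refl : Rᵐᵒᵖ ≃ₐ[k] Rᵐᵒᵖ))

end Silting

end

end WakamatsuSilting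

open WakamatsuSilting

/-! Write `P` for `R` and `J` for `DR`, as stalk complexes. Projectivity gives Hⁿ(X) = 0 iff Hom(P,
X[n]) = 0, and duality gives Hⁿ(X) = 0 iff Hom(X, J[-n]) = 0. Apart from these two tests, the
equivalence of 1 and 2 uses only the existence of `add T`-approximations, which holds because Hom
groups in the bounded derived category are finitely generated over `k`.

For 1 → 2, let P ≅ X₀[n] with triangles X_l → M_l → X_{l+1}. Shift `J` to Y₀ = J[m], with m ≥ 0 so
large that neither `T` nor any X_l has nonzero morphisms to Y₀[j] for j > 0, and let Y_{i+1} be the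
cocone of a right `add T`-approximation N_i → Y_i. The difficulty is to bound the cohomology of all
Y_i at once. The lower bound comes from the long exact sequence. The upper bound comes from Hom(X_l,
Y_i[j]) = 0 for all l, i and all j > 0, proved by induction on i. In the critical degree j = 1, a
morphism X_l → Y_i extends to M_l because Hom(X_{l+1}, Y_i[1]) = 0, and the extension factors
through N_i because M_l is in `add T`. For l = 0 this says Hʲ(Y_i) = 0 for j > n. The implication 2
→ 1 is dual, with cones of left approximations.

For 2 ↔ 3, `D` is an equivalence from D^b(mod R)ᵒᵖ to D^b(mod Rᵒᵖ) that reverses triangles, negates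
cohomological degrees and takes `DR` to the regular module. It therefore exchanges Auslander and
co-Auslander classes. All notions involved ask only for the existence of triangles and isomorphisms,
so triangles can be transported as short exact sequences of complexes, and no signs or coherent
shift isomorphisms for `D` are needed. -/

namespace WakamatsuSilting

open Limits Pretriangulated

/-! ### Vanishing of Hom groups along triangles. -/

section Vanishing

variable {C : Type u} [Category.{v} C] [Abelian C] [HasDerivedCategory.{w} C]

/-- All morphisms `X ⟶ Y⟦n⟧` vanish. -/
def HomVanishes (X Y : DerivedCategory.Bounded C) (n : ℤ) : Prop := ∀ f : X ⟶ Y⟦n⟧, f = 0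

namespace HomVanishes

variable {X X' Y Y' Z W : DerivedCategory.Bounded C} {n m : ℤ}

theorem of_iso (h : HomVanishes X Y n) (e : X ≅ X') (e' : Y ≅ Y') : HomVanishes X' Y' n := by
  intro f
  have := h (e.hom ≫ f ≫ e'.inv⟦n⟧')
  rw [← cancel_epi e.hom, ← cancel_mono (e'.inv⟦n⟧'), Category.assoc, this]
  simp

theorem shift_right_iff (a : ℤ) (hm : a + n = m) :
    HomVanishes X (Y⟦a⟧) n ↔ HomVanishes X Y m := by
  let e : Y⟦m⟧ ≅ Y⟦a⟧⟦n⟧ := (shiftFunctorAdd' _ a n m hm).app Y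
  constructor
  · intro h f
    rw [← cancel_mono e.hom, zero_comp]
    exact h _
  · intro h f
    rw [← cancel_mono e.inv, zero_comp]
    exact h _

theorem shift_shift_iff (a : ℤ) : HomVanishes (X⟦a⟧) (Y⟦a⟧) n ↔ HomVanishes X Y n := by
  let e : Y⟦n⟧⟦a⟧ ≅ Y⟦a⟧⟦n⟧ := shiftComm Y n a
  constructor
  · intro h f
    have := h (f⟦a⟧' ≫ e.hom)
    rw [← cancel_mono e.inv, zero_comp, Category.assoc, e.hom_inv_id, Category.comp_id] at this
    exact (shiftFunctor _ a).map_injective (by rw [this, Functor.map_zero])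
  · intro h f
    obtain ⟨g, hg⟩ := (shiftFunctor _ a).map_surjective (f ≫ e.inv)
    rw [← cancel_mono e.inv, zero_comp, ← hg, h g, Functor.map_zero]

theorem shift_left_iff (a : ℤ) (hm : a + m = n) :
    HomVanishes (X⟦a⟧) Y n ↔ HomVanishes X Y m := by
  rw [← shift_shift_iff (X := X) a, shift_right_iff a hm]

end HomVanishes

section Triangle

variable {X Y Z W : DerivedCategory.Bounded C}

theorem HasTriangle.rotate (h : HasTriangle X Y Z) : HasTriangle Y Z (X⟦(1 : ℤ)⟧) := by
  obtain ⟨f, g, h, hT⟩ := h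
  exact ⟨_, _, _, rot_of_distTriang _ hT⟩

theorem HasTriangle.shift (h : HasTriangle X Y Z) (n : ℤ) :
    HasTriangle (X⟦n⟧) (Y⟦n⟧) (Z⟦n⟧) := by
  obtain ⟨f, g, h, hT⟩ := h
  exact ⟨_, _, _, Triangle.shift_distinguished _ hT n⟩

theorem HasTriangle.of_iso {X' Y' Z' : DerivedCategory.Bounded C} (h : HasTriangle X Y Z)
    (e₁ : X ≅ X') (e₂ : Y ≅ Y') (e₃ : Z ≅ Z') : HasTriangle X' Y' Z' := by
  obtain ⟨f, g, h, hT⟩ := h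
  refine ⟨e₁.inv ≫ f ≫ e₂.hom, e₂.inv ≫ g ≫ e₃.hom, e₃.inv ≫ h ≫ e₁.hom⟦1⟧',
    isomorphic_distinguished _ hT _ (Iso.symm (Triangle.isoMk _ _ e₁ e₂ e₃ ?_ ?_ ?_))⟩
  · exact (e₁.hom_inv_id_assoc _).symm
  · exact (e₂.hom_inv_id_assoc _).symm
  · exact (e₃.hom_inv_id_assoc _).symm

theorem HasTriangle.homVanishes_to_two (h : HasTriangle X Y Z) {n : ℤ}
    (h₁ : HomVanishes W X n) (h₃ : HomVanishes W Z n) : HomVanishes W Y n := by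
  obtain ⟨f, g, k, hT⟩ := h.shift n
  intro φ
  obtain ⟨ψ, hψ⟩ : ∃ ψ : W ⟶ X⟦n⟧, φ = ψ ≫ f := Triangle.coyoneda_exact₂ _ hT φ (h₃ _)
  rw [hψ, h₁ ψ, zero_comp]

theorem HasTriangle.homVanishes_to_one (h : HasTriangle X Y Z) {n m : ℤ} (hm : n + 1 = m)
    (h₃ : HomVanishes W Z n) (h₂ : HomVanishes W Y m) : HomVanishes W X m := by
  have := h.rotate.rotate.homVanishes_to_two (W := W) (n := n) h₃
    ((HomVanishes.shift_right_iff 1 (by lia)).2 h₂)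
  exact (HomVanishes.shift_right_iff 1 (by lia)).1 this

theorem HasTriangle.homVanishes_from_two (h : HasTriangle X Y Z) {n : ℤ}
    (h₁ : HomVanishes X W n) (h₃ : HomVanishes Z W n) : HomVanishes Y W n := by
  obtain ⟨f, g, k, hT⟩ := h
  intro φ
  obtain ⟨ψ, hψ⟩ : ∃ ψ : Z ⟶ W⟦n⟧, φ = g ≫ ψ := Triangle.yoneda_exact₂ _ hT φ (h₁ _)
  rw [hψ, h₃ ψ, comp_zero]

theorem HasTriangle.homVanishes_from_three (h : HasTriangle X Y Z) {n m : ℤ} (hm : n + 1 = m)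
    (h₁ : HomVanishes X W n) (h₂ : HomVanishes Y W m) : HomVanishes Z W m :=
  h.rotate.homVanishes_from_two h₂ ((HomVanishes.shift_left_iff 1 (by lia)).2 h₁)

end Triangle

/-! ### The class `add M` and approximations by it. -/

section AddClosure

variable {M N X : DerivedCategory.Bounded C}

/-- This form of membership in `add M` mentions no biproducts and is self-dual, so it passes through
vanishing arguments and contravariant functors directly. -/
theorem exists_sum_eq_id_of_addClosure (h : addClosure M N) :
    ∃ (n : ℕ) (f : Fin n → (N ⟶ M)) (g : Fin n → (M ⟶ N)), ∑ i, f i ≫ g i = 𝟙 N := by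
  obtain ⟨n, N', ⟨e⟩⟩ := h
  refine ⟨n, fun i => biprod.inl ≫ e.hom ≫ biproduct.π _ i,
    fun i => biproduct.ι (fun _ : Fin n => M) i ≫ e.inv ≫ biprod.fst, ?_⟩
  have h : ∑ i, biproduct.π (fun _ : Fin n => M) i ≫ biproduct.ι (fun _ : Fin n => M) i = 𝟙 _ :=
    biproduct.total
  calc _ = biprod.inl ≫ e.hom ≫ (∑ i, biproduct.π (fun _ : Fin n => M) i ≫
        biproduct.ι (fun _ : Fin n => M) i) ≫ e.inv ≫ biprod.fst := by
        simp only [Preadditive.comp_sum, Preadditive.sum_comp, Category.assoc]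
    _ = _ := by rw [h]; simp

/-- The `f i` assemble to a split monomorphism into a power of `M`. In a triangle on it the
connecting morphism vanishes, so the triangle splits and its third term is the required complement.
-/
theorem addClosure_of_sum_eq_id {n : ℕ} (f : Fin n → (N ⟶ M)) (g : Fin n → (M ⟶ N))
    (hfg : ∑ i, f i ≫ g i = 𝟙 N) : addClosure M N := by
  let i : N ⟶ ⨁ fun _ : Fin n => M := biproduct.lift f
  let p : (⨁ fun _ : Fin n => M) ⟶ N := biproduct.desc g
  have hip : i ≫ p = 𝟙 N := by rw [← hfg]; exact biproduct.lift_desc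
  obtain ⟨Z, q, δ, hT⟩ := distinguished_cocone_triangle i
  have hδ : δ = 0 := by
    have h : δ ≫ i⟦(1 : ℤ)⟧' = 0 := comp_distTriang_mor_zero₃₁ _ hT
    have h' : δ ≫ (i ≫ p)⟦(1 : ℤ)⟧' = 0 := by
      rw [Functor.map_comp, reassoc_of% h, zero_comp]
    simpa [hip] using h'
  obtain ⟨e, -⟩ := exists_iso_binaryBiproduct_of_distTriang _ hT hδ
  exact ⟨n, Z, ⟨e.symm⟩⟩

theorem HomVanishes.of_addClosure_left {n : ℤ} (h : HomVanishes M X n) (hN : addClosure M N) :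
    HomVanishes N X n := by
  obtain ⟨m, f, g, hfg⟩ := exists_sum_eq_id_of_addClosure hN
  intro φ
  rw [← Category.id_comp φ, ← hfg, Preadditive.sum_comp]
  refine Finset.sum_eq_zero fun i _ => ?_
  rw [Category.assoc, h (g i ≫ φ), comp_zero]

theorem HomVanishes.of_addClosure_right {n : ℤ} (h : HomVanishes X M n) (hN : addClosure M N) :
    HomVanishes X N n := by
  obtain ⟨m, f, g, hfg⟩ := exists_sum_eq_id_of_addClosure hN
  intro φ
  rw [← Category.comp_id φ, ← CategoryTheory.Functor.map_id, ← hfg,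
    Functor.map_sum, Preadditive.comp_sum]
  refine Finset.sum_eq_zero fun i _ => ?_
  rw [Functor.map_comp, ← Category.assoc, h (φ ≫ (f i)⟦n⟧'), zero_comp]

/-- `f : N ⟶ Y` is a right `add M`-approximation. -/
def IsRightApproximation (M : DerivedCategory.Bounded C) {N Y : DerivedCategory.Bounded C}
    (f : N ⟶ Y) : Prop :=
  addClosure M N ∧ ∀ g : M ⟶ Y, ∃ h : M ⟶ N, h ≫ f = g

/-- `f : Y ⟶ N` is a left `add M`-approximation. -/
def IsLeftApproximation (M : DerivedCategory.Bounded C) {N Y : DerivedCategory.Bounded C}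
    (f : Y ⟶ N) : Prop :=
  addClosure M N ∧ ∀ g : Y ⟶ M, ∃ h : N ⟶ M, f ≫ h = g

theorem IsRightApproximation.exists_fac {N' Y : DerivedCategory.Bounded C} {f : N ⟶ Y}
    (hf : IsRightApproximation M f) (hN' : addClosure M N') (g : N' ⟶ Y) :
    ∃ h : N' ⟶ N, h ≫ f = g := by
  obtain ⟨m, p, q, hpq⟩ := exists_sum_eq_id_of_addClosure hN'
  choose h hh using fun i => hf.2 (q i ≫ g)
  refine ⟨∑ i, p i ≫ h i, ?_⟩
  rw [Preadditive.sum_comp]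
  simp only [Category.assoc, hh]
  simp only [← Category.assoc]
  rw [← Preadditive.sum_comp, hpq, Category.id_comp]

theorem IsLeftApproximation.exists_fac {N' Y : DerivedCategory.Bounded C} {f : Y ⟶ N}
    (hf : IsLeftApproximation M f) (hN' : addClosure M N') (g : Y ⟶ N') :
    ∃ h : N ⟶ N', f ≫ h = g := by
  obtain ⟨m, p, q, hpq⟩ := exists_sum_eq_id_of_addClosure hN'
  choose h hh using fun i => hf.2 (g ≫ p i)
  refine ⟨∑ i, h i ≫ q i, ?_⟩
  rw [Preadditive.comp_sum]
  simp only [← Category.assoc, hh]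
  simp only [Category.assoc]
  rw [← Preadditive.comp_sum, hpq, Category.comp_id]

end AddClosure

section Approximation

variable {X Y Z M N N' : DerivedCategory.Bounded C}

/-- If every morphism `W ⟶ Z` factors through the second morphism of a triangle `X ⟶ Y ⟶ Z ⟶`
and `Hom(W, Y[1]) = 0`, then `Hom(W, X[1]) = 0`. -/
theorem homVanishes_one_of_fac_right {W : DerivedCategory.Bounded C} {f : X ⟶ Y} {g : Y ⟶ Z}
    {h : Z ⟶ X⟦(1 : ℤ)⟧} (hT : Triangle.mk f g h ∈ distTriang _)
    (hfac : ∀ φ : W ⟶ Z, ∃ ψ : W ⟶ Y, ψ ≫ g = φ) (h₂ : HomVanishes W Y 1) :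
    HomVanishes W X 1 := by
  intro φ
  obtain ⟨ψ, hψ⟩ : ∃ ψ : W ⟶ Z, φ = ψ ≫ h := Triangle.coyoneda_exact₁ _ hT φ (h₂ _)
  obtain ⟨χ, rfl⟩ := hfac ψ
  have hz : g ≫ h = 0 := comp_distTriang_mor_zero₂₃ _ hT
  rw [hψ, Category.assoc, hz, comp_zero]

/-- If every morphism `X ⟶ W` factors through the first morphism of a triangle `X ⟶ Y ⟶ Z ⟶`
and `Hom(Y, W[1]) = 0`, then `Hom(Z, W[1]) = 0`. -/
theorem homVanishes_one_of_fac_left {W : DerivedCategory.Bounded C} {f : X ⟶ Y} {g : Y ⟶ Z}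
    {h : Z ⟶ X⟦(1 : ℤ)⟧} (hT : Triangle.mk f g h ∈ distTriang _)
    (hfac : ∀ φ : X ⟶ W, ∃ ψ : Y ⟶ W, f ≫ ψ = φ) (h₂ : HomVanishes Y W 1) :
    HomVanishes Z W 1 := by
  intro φ
  obtain ⟨ψ, hψ⟩ : ∃ ψ : X⟦(1 : ℤ)⟧ ⟶ W⟦(1 : ℤ)⟧, φ = h ≫ ψ :=
    Triangle.yoneda_exact₃ _ hT φ (h₂ _)
  obtain ⟨ψ', rfl⟩ := (shiftFunctor _ (1 : ℤ)).map_surjective ψ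
  obtain ⟨χ, rfl⟩ := hfac ψ'
  have hz : h ≫ f⟦(1 : ℤ)⟧' = 0 := comp_distTriang_mor_zero₃₁ _ hT
  rw [hψ, Functor.map_comp, ← Category.assoc, hz, zero_comp]

/-- A morphism `X ⟶ W` with `Hom(Z, W[1]) = 0` extends along the first morphism of a triangle
`X ⟶ Y ⟶ Z ⟶`. -/
theorem exists_fac_of_homVanishes_one {W : DerivedCategory.Bounded C} {f : X ⟶ Y} {g : Y ⟶ Z}
    {h : Z ⟶ X⟦(1 : ℤ)⟧} (hT : Triangle.mk f g h ∈ distTriang _) (hZ : HomVanishes Z W 1)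
    (φ : X ⟶ W) : ∃ ψ : Y ⟶ W, f ≫ ψ = φ := by
  have h0 : h ≫ φ⟦(1 : ℤ)⟧' = 0 := hZ _
  -- Rotation puts a sign on `f⟦1⟧`; the witness `-ψ'` below absorbs it.
  obtain ⟨ψ, hψ⟩ : ∃ ψ : Y⟦(1 : ℤ)⟧ ⟶ W⟦(1 : ℤ)⟧, φ⟦(1 : ℤ)⟧' = (-f⟦(1 : ℤ)⟧') ≫ ψ :=
    Triangle.yoneda_exact₃ _ (rot_of_distTriang _ hT) (φ⟦(1 : ℤ)⟧') h0
  obtain ⟨ψ', rfl⟩ := (shiftFunctor _ (1 : ℤ)).map_surjective ψ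
  refine ⟨-ψ', (shiftFunctor _ (1 : ℤ)).map_injective ?_⟩
  rw [hψ, Functor.map_comp, Functor.map_neg]
  simp

/-- A morphism `W ⟶ Z` with `Hom(W, X[1]) = 0` lifts along the second morphism of a triangle
`X ⟶ Y ⟶ Z ⟶`. -/
theorem exists_lift_of_homVanishes_one {W : DerivedCategory.Bounded C} {f : X ⟶ Y} {g : Y ⟶ Z}
    {h : Z ⟶ X⟦(1 : ℤ)⟧} (hT : Triangle.mk f g h ∈ distTriang _) (hX : HomVanishes W X 1)
    (φ : W ⟶ Z) : ∃ ψ : W ⟶ Y, ψ ≫ g = φ := by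
  obtain ⟨ψ, hψ⟩ : ∃ ψ : W ⟶ Y, φ = ψ ≫ g := Triangle.coyoneda_exact₃ _ hT φ (hX _)
  exact ⟨ψ, hψ.symm⟩

end Approximation

theorem exists_cohomologyIn (X : DerivedCategory.Bounded C) : ∃ a b : ℤ, cohomologyIn a b X := by
  obtain ⟨X, ⟨a, ha⟩, ⟨b, hb⟩⟩ := X
  refine ⟨a, b, fun n hn => ?_⟩
  rw [Set.mem_Icc, not_and_or, not_le, not_le] at hn
  exact hn.elim (fun h => DerivedCategory.isZero_of_isGE X a n h)
    (fun h => DerivedCategory.isZero_of_isLE X b n h)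

theorem cohomologyIn.mono {X : DerivedCategory.Bounded C} {a b a' b' : ℤ}
    (h : cohomologyIn a b X) (ha : a' ≤ a) (hb : b ≤ b') : cohomologyIn a' b' X :=
  fun n hn => h n fun hn' => hn ⟨ha.trans hn'.1, hn'.2.trans hb⟩

end Vanishing

/-! ### The symmetry between conditions 1 and 2. -/

section Symmetry

variable {C : Type u} [Category.{v} C] [Abelian C] [HasDerivedCategory.{w} C]
  {P J : DerivedCategory.Bounded C}

/-- `P` detects cohomology covariantly: `Hⁿ X = 0` if and only if `Hom(P, X[n]) = 0`. -/
def DetectsCohomology (P : DerivedCategory.Bounded C) : Prop :=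
  ∀ (X : DerivedCategory.Bounded C) (n : ℤ),
    IsZero ((DerivedCategory.homologyFunctor C n).obj X.obj) ↔ HomVanishes P X n

/-- `J` detects cohomology contravariantly: `Hⁿ X = 0` if and only if `Hom(X, J[-n]) = 0`. -/
def CodetectsCohomology (J : DerivedCategory.Bounded C) : Prop :=
  ∀ (X : DerivedCategory.Bounded C) (n : ℤ),
    IsZero ((DerivedCategory.homologyFunctor C n).obj X.obj) ↔ HomVanishes X J (-n)

variable {T : DerivedCategory.Bounded C}

/-- The given coresolution of a shift of `P` bounds from above the cohomology of the resolution of a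
shift of `J` by iterated right approximations. -/
theorem nonposShifts_auslanderClass_of_nonnegShifts_coAuslanderClass
    (hP : DetectsCohomology P) (hJ : CodetectsCohomology J)
    (happ : ∀ Y : DerivedCategory.Bounded C, ∃ (N : _) (f : N ⟶ Y), IsRightApproximation T f)
    (hT : IsSemiSelforthogonal T) (h : nonnegShifts (coAuslanderClass T) P) :
    nonposShifts (auslanderClass T) J := by
  obtain ⟨n, Z, hn, ⟨a, b, hTab, X, M, rfl, hX⟩, ⟨e⟩⟩ := h
  obtain ⟨c, d, hJcd⟩ := exists_cohomologyIn J
  choose N f hf using happ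
  choose Y' g δ hY' using fun Y => distinguished_cocone_triangle₁ (f Y)
  -- `0 ≤ m` makes `J` a nonpositive shift of `J⟦m⟧`. By `-a ≤ m`, the degrees `-(m + i)` with `i >
  -- 0` lie below `a`, where `T` and all `X l` have no cohomology.
  let m : ℤ := max 0 (-a)
  let Y : ℕ → DerivedCategory.Bounded C := fun i => Nat.rec (J⟦m⟧) (fun _ => Y') i
  have hvan : ∀ W : DerivedCategory.Bounded C, cohomologyIn a b W → ∀ i : ℤ, 0 < i →
      HomVanishes W (J⟦m⟧) i := by
    intro W hW i hi
    have := (hJ W (-(m + i))).1 (hW _ fun h => by have := h.1; lia)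
    rw [neg_neg] at this
    exact (HomVanishes.shift_right_iff m rfl).2 this
  have hTM : ∀ i : ℕ, rightPerp T (Y i) := by
    intro i
    induction i with
    | zero => exact hvan T hTab
    | succ i ih =>
      intro j hj
      -- For `j = 1` the preceding Hom group has degree 0 and need not vanish; the approximation
      -- property replaces vanishing there.
      obtain rfl | hj' : j = 1 ∨ 1 < j := by lia
      · exact homVanishes_one_of_fac_right (hY' (Y i)) (hf (Y i)).2
          (HomVanishes.of_addClosure_right (hT 1 hj) (hf (Y i)).1)
      · exact HasTriangle.homVanishes_to_one ⟨_, _, _, hY' (Y i)⟩ (n := j - 1) (by lia)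
          (ih (j - 1) (by lia)) (HomVanishes.of_addClosure_right (hT j hj) (hf (Y i)).1)
  -- The statement ranges over all `l` because the inductive step for `X l` uses the hypothesis for
  -- `X (l + 1)`.
  have hXY : ∀ (i l : ℕ) (j : ℤ), 0 < j → HomVanishes (X l) (Y i) j := by
    intro i
    induction i with
    | zero => exact fun l => hvan _ (hX l).2.2.2
    | succ i ih =>
      intro l j hj
      have hXN : HomVanishes (X l) (N (Y i)) j :=
        HomVanishes.of_addClosure_right ((hX l).2.2.1 j hj) (hf (Y i)).1
      obtain rfl | hj' : j = 1 ∨ 1 < j := by lia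
      · refine homVanishes_one_of_fac_right (hY' (Y i)) (fun φ => ?_) hXN
        obtain ⟨p, q, r, hpqr⟩ := (hX l).1
        -- Extend `φ` to the middle term in `add T`, then factor that extension through the
        -- approximation of `Y i`.
        obtain ⟨ψ, rfl⟩ := exists_fac_of_homVanishes_one hpqr (ih (l + 1) 1 one_pos) φ
        obtain ⟨χ, rfl⟩ := (hf (Y i)).exists_fac (hX l).2.1 ψ
        exact ⟨p ≫ χ, Category.assoc _ _ _⟩
      · exact HasTriangle.homVanishes_to_one ⟨_, _, _, hY' (Y i)⟩ (n := j - 1) (by lia)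
          (ih l (j - 1) (by lia)) hXN
  -- `J⟦m⟧` starts in degree `c - m` and objects of `add T` in degree `a`. Taking cocones cannot
  -- lower the smaller of these bounds.
  have hlow : ∀ (i : ℕ) (j : ℤ), j < min a (c - m) → HomVanishes P (Y i) j := by
    intro i
    induction i with
    | zero =>
      intro j hj
      refine (HomVanishes.shift_right_iff m rfl).2 ((hP J _).1 (hJcd _ fun h => ?_))
      have := h.1
      lia
    | succ i ih =>
      intro j hj
      exact HasTriangle.homVanishes_to_one ⟨_, _, _, hY' (Y i)⟩ (n := j - 1) (by lia)
        (ih (j - 1) (by lia)) (HomVanishes.of_addClosure_right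
          ((hP T j).1 (hTab _ fun h => by have := h.1; lia)) (hf (Y i)).1)
  refine ⟨-m, J⟦m⟧, by lia, ⟨min a (c - m), max b n, hTab.mono (min_le_left _ _) (le_max_left _ _),
    Y, fun i => N (Y i), rfl, fun i => ⟨⟨_, _, _, hY' (Y i)⟩, (hf (Y i)).1, hTM i, ?_⟩⟩,
    ⟨((shiftEquiv _ m).unitIso.app J)⟩⟩
  intro j hj
  rw [hP]
  by_cases hj' : j < min a (c - m)
  · exact hlow i j hj'
  · have hnj : n < j := by
      by_contra h
      exact hj ⟨by lia, by lia⟩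
    -- Since `P ≅ X 0⟦n⟧`, the cohomology of `Y i` in degree `j` is tested by morphisms from `X 0`
    -- to `Y i` of degree `j - n > 0`.
    exact HomVanishes.of_iso ((HomVanishes.shift_left_iff n (m := j - n) (by lia)).2
      (hXY i 0 (j - n) (by lia))) e.symm (Iso.refl _)

/-- The dual argument: cones of left approximations start from `P⟦-m⟧`. Here the upper bound is
automatic and the lower bound comes from the given resolution. -/
theorem nonnegShifts_coAuslanderClass_of_nonposShifts_auslanderClass
    (hP : DetectsCohomology P) (hJ : CodetectsCohomology J)
    (happ : ∀ Y : DerivedCategory.Bounded C, ∃ (N : _) (f : Y ⟶ N), IsLeftApproximation T f)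
    (hT : IsSemiSelforthogonal T) (h : nonposShifts (auslanderClass T) J) :
    nonnegShifts (coAuslanderClass T) P := by
  obtain ⟨n, Z, hn, ⟨a, b, hTab, X, M, rfl, hX⟩, ⟨e⟩⟩ := h
  obtain ⟨c, d, hPcd⟩ := exists_cohomologyIn P
  choose N f hf using happ
  choose Y' g δ hY' using fun Y => distinguished_cocone_triangle (f Y)
  -- `P⟦-m⟧` tests cohomology in degrees `m + i > b`, beyond that of `T` and all `X l`.
  let m : ℤ := max 0 b
  let Y : ℕ → DerivedCategory.Bounded C := fun i => Nat.rec (P⟦-m⟧) (fun _ => Y') i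
  have hvan : ∀ W : DerivedCategory.Bounded C, cohomologyIn a b W → ∀ i : ℤ, 0 < i →
      HomVanishes (P⟦-m⟧) W i := by
    intro W hW i hi
    exact (HomVanishes.shift_left_iff (-m) (m := m + i) (by lia)).2
      ((hP W (m + i)).1 (hW _ fun h => by have := h.2; lia))
  have hTM : ∀ i : ℕ, leftPerp T (Y i) := by
    intro i
    induction i with
    | zero => exact hvan T hTab
    | succ i ih =>
      intro j hj
      obtain rfl | hj' : j = 1 ∨ 1 < j := by lia
      · exact homVanishes_one_of_fac_left (hY' (Y i)) (hf (Y i)).2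
          (HomVanishes.of_addClosure_left (hT 1 hj) (hf (Y i)).1)
      · exact HasTriangle.homVanishes_from_three ⟨_, _, _, hY' (Y i)⟩ (n := j - 1) (by lia)
          (ih (j - 1) (by lia)) (HomVanishes.of_addClosure_left (hT j hj) (hf (Y i)).1)
  have hXY : ∀ (i l : ℕ) (j : ℤ), 0 < j → HomVanishes (Y i) (X l) j := by
    intro i
    induction i with
    | zero => exact fun l => hvan _ (hX l).2.2.2
    | succ i ih =>
      intro l j hj
      have hXN : HomVanishes (N (Y i)) (X l) j :=
        HomVanishes.of_addClosure_left ((hX l).2.2.1 j hj) (hf (Y i)).1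
      obtain rfl | hj' : j = 1 ∨ 1 < j := by lia
      · refine homVanishes_one_of_fac_left (hY' (Y i)) (fun φ => ?_) hXN
        obtain ⟨p, q, r, hpqr⟩ := (hX l).1
        obtain ⟨ψ, rfl⟩ := exists_lift_of_homVanishes_one hpqr (ih (l + 1) 1 one_pos) φ
        obtain ⟨χ, rfl⟩ := (hf (Y i)).exists_fac (hX l).2.1 ψ
        exact ⟨χ ≫ q, (Category.assoc _ _ _).symm⟩
      · exact HasTriangle.homVanishes_from_three ⟨_, _, _, hY' (Y i)⟩ (n := j - 1) (by lia)
          (ih l (j - 1) (by lia)) hXN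
  -- `P⟦-m⟧` ends in degree `d + m` and objects of `add T` in degree `b`; cones cannot raise the
  -- larger of these bounds.
  have hhigh : ∀ (i : ℕ) (j : ℤ), max b (d + m) < j → HomVanishes (Y i) J (-j) := by
    intro i
    induction i with
    | zero =>
      intro j hj
      refine (HomVanishes.shift_left_iff (-m) (m := -(j - m)) (by lia)).2
        ((hJ P _).1 (hPcd _ fun h => ?_))
      have := h.2
      lia
    | succ i ih =>
      intro j hj
      exact HasTriangle.homVanishes_from_three ⟨_, _, _, hY' (Y i)⟩ (n := -(j + 1)) (by lia)
        (ih (j + 1) (by lia)) (HomVanishes.of_addClosure_left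
          ((hJ T j).1 (hTab _ fun h => by have := h.2; lia)) (hf (Y i)).1)
  refine ⟨m, P⟦-m⟧, by lia, ⟨min a n, max b (d + m), hTab.mono (min_le_left _ _) (le_max_left _ _),
    Y, fun i => N (Y i), rfl, fun i => ⟨⟨_, _, _, hY' (Y i)⟩, (hf (Y i)).1, hTM i, ?_⟩⟩,
    ⟨((shiftEquiv _ m).counitIso.app P).symm⟩⟩
  intro j hj
  rw [hJ]
  by_cases hj' : max b (d + m) < j
  · exact hhigh i j hj'
  · have hnj : j < n := by
      by_contra h
      exact hj ⟨by lia, by lia⟩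
    -- Since `J ≅ X 0⟦n⟧`, degree `j < n` is tested by morphisms from `Y i` to `X 0` of degree `n -
    -- j > 0`.
    exact HomVanishes.of_iso ((HomVanishes.shift_right_iff n (m := n - j) (by lia)).2
      (hXY i 0 (n - j) (by lia))) (Iso.refl _) e.symm

end Symmetry

/-! ### Projective generators detect cohomology. -/

section Projective

variable {C : Type u} [Category.{v} C] [Abelian C]

instance isKProjective_singleFunctor_obj (P : C) [Projective P] (n : ℤ) :
    ((CochainComplex.singleFunctor C n).obj P).IsKProjective := by
  have (i : ℤ) : Projective (((CochainComplex.singleFunctor C n).obj P).X i) := by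
    by_cases h : i = n
    · exact Projective.of_iso (HomologicalComplex.singleObjXIsoOfEq _ n P i h).symm ‹_›
    · exact (HomologicalComplex.isZero_single_obj_X _ n P i h).projective
  exact CochainComplex.isKProjective_of_projective _ n

variable [HasDerivedCategory.{w} C]

/-- Out of a K-projective complex, morphisms in the derived category are homotopy classes of chain
maps. -/
theorem exists_Q_map_eq_of_isKProjective {K L : CochainComplex C ℤ} [K.IsKProjective]
    (f : DerivedCategory.Q.obj K ⟶ DerivedCategory.Q.obj L) :
    ∃ g : K ⟶ L, DerivedCategory.Q.map g = f := by
  obtain ⟨g', hg'⟩ := (CochainComplex.IsKProjective.Qh_map_bijective K _).surjective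
    ((DerivedCategory.quotientCompQhIso C).hom.app K ≫ f ≫
      (DerivedCategory.quotientCompQhIso C).inv.app L)
  obtain ⟨g, rfl⟩ := (HomotopyCategory.quotient _ _).map_surjective g'
  refine ⟨g, ?_⟩
  rw [← cancel_epi ((DerivedCategory.quotientCompQhIso C).hom.app K),
    ← DerivedCategory.quotientCompQhIso_hom_naturality, hg']
  simp

open CochainComplex.HomComplex in
/-- Morphisms from a projective object placed in degree `n` to a complex without cohomology in
degree `n` vanish in the derived category. -/
theorem eq_zero_of_isZero_homology (P : C) [Projective P] (n : ℤ) (X : DerivedCategory C)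
    (hX : IsZero ((DerivedCategory.homologyFunctor C n).obj X))
    (f : (DerivedCategory.singleFunctor C n).obj P ⟶ X) : f = 0 := by
  obtain ⟨K, ⟨e⟩⟩ : ∃ K, Nonempty (DerivedCategory.Q.obj K ≅ X) :=
    ⟨_, ⟨DerivedCategory.Q.objObjPreimageIso X⟩⟩
  obtain ⟨g, hg⟩ := exists_Q_map_eq_of_isKProjective
    (K := (CochainComplex.singleFunctor C n).obj P) (L := K) (f ≫ e.inv)
  have hK : K.ExactAt n := by
    rw [HomologicalComplex.exactAt_iff_isZero_homology]
    exact hX.of_iso (((DerivedCategory.homologyFunctorFactors C n).symm.app _) ≪≫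
      (DerivedCategory.homologyFunctor C n).mapIso e)
  rw [HomologicalComplex.exactAt_iff' _ (n - 1) n (n + 1) (by simp) (by simp)] at hK
  obtain ⟨φ, hφ, hφ'⟩ :=
    -- The chain map `g` amounts to `φ : P ⟶ K.X n` killed by the differential. By exactness and
    -- projectivity `φ` lifts to `K.X (n - 1)`, and the lift is a null-homotopy.
    Cocycle.fromSingleMk_surjective (Cocycle.ofHom g) n (add_zero n) (n + 1) rfl
  obtain ⟨χ, hχ⟩ : ∃ χ : P ⟶ K.X (n - 1), χ ≫ K.d (n - 1) n = φ :=
    ⟨hK.liftFromProjective φ hφ, hK.liftFromProjective_comp φ hφ⟩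
  have hom : Homotopy g 0 := (Cochain.equivHomotopy g 0).symm
    ⟨Cochain.fromSingleMk χ (by lia), by
      rw [Cochain.δ_fromSingleMk _ _ _ n (add_zero n), Cochain.ofHom_zero, add_zero, hχ]
      exact (congrArg Subtype.val hφ').symm⟩
  have := DerivedCategory.Q_map_eq_of_homotopy C hom
  rw [hg, Functor.map_zero] at this
  exact (cancel_mono e.inv).1 (this.trans zero_comp.symm)

/-- The cohomology of the image of a complex in the derived category. -/
noncomputable def homologyQIso (K : CochainComplex C ℤ) (n : ℤ) :
    (DerivedCategory.homologyFunctor C n).obj (DerivedCategory.Q.obj K) ≅ K.homology n :=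
  (DerivedCategory.homologyFunctorFactors C n).app K

theorem homologyFunctor_map_Q_map {K L : CochainComplex C ℤ} (g : K ⟶ L) (n : ℤ) :
    (DerivedCategory.homologyFunctor C n).map (DerivedCategory.Q.map g) =
      (homologyQIso K n).hom ≫ HomologicalComplex.homologyMap g n ≫ (homologyQIso L n).inv := by
  rw [← Category.assoc, Iso.eq_comp_inv]
  exact DerivedCategory.homologyFunctorFactors_hom_naturality g n

/-- Morphisms from a projective object to the cohomology of `X` are induced by morphisms in the
derived category. -/
theorem exists_homologyFunctor_map_eq (P : C) [Projective P] (n : ℤ) (X : DerivedCategory C)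
    (φ : P ⟶ (DerivedCategory.homologyFunctor C n).obj X) :
    ∃ (e : P ≅ (DerivedCategory.homologyFunctor C n).obj
        ((DerivedCategory.singleFunctor C n).obj P))
      (f : (DerivedCategory.singleFunctor C n).obj P ⟶ X),
      e.hom ≫ (DerivedCategory.homologyFunctor C n).map f = φ := by
  obtain ⟨K, ⟨e⟩⟩ : ∃ K, Nonempty (DerivedCategory.Q.obj K ≅ X) :=
    ⟨_, ⟨DerivedCategory.Q.objObjPreimageIso X⟩⟩
  -- A morphism to cohomology lifts to cycles by projectivity, and a morphism to cycles is a chain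
  -- map out of the stalk complex.
  let ψ : P ⟶ K.cycles n := Projective.factorThru
    (φ ≫ (DerivedCategory.homologyFunctor C n).map e.inv ≫ (homologyQIso K n).hom) (K.homologyπ n)
  have hψ : ψ ≫ K.homologyπ n =
      φ ≫ (DerivedCategory.homologyFunctor C n).map e.inv ≫ (homologyQIso K n).hom :=
    Projective.factorThru_comp _ _
  let g : (HomologicalComplex.single C (ComplexShape.up ℤ) n).obj P ⟶ K :=
    HomologicalComplex.mkHomFromSingle (ψ ≫ K.iCycles n) (fun k _ => by simp)
  have hg : (HomologicalComplex.singleObjHomologySelfIso _ n P).inv ≫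
      HomologicalComplex.homologyMap g n = ψ ≫ K.homologyπ n := by
    rw [← HomologicalComplex.singleObjCyclesSelfIso_inv_homologyπ, Category.assoc,
      HomologicalComplex.homologyπ_naturality, ← Category.assoc]
    congr 1
    rw [← cancel_mono (K.iCycles n), Category.assoc, HomologicalComplex.cyclesMap_i,
      HomologicalComplex.singleObjCyclesSelfIso_inv_iCycles_assoc,
      HomologicalComplex.mkHomFromSingle_f, Iso.inv_hom_id_assoc]
  have main : ((HomologicalComplex.singleObjHomologySelfIso _ n P).symm ≪≫
      (homologyQIso _ n).symm).hom ≫ (DerivedCategory.homologyFunctor C n).map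
        (DerivedCategory.Q.map g ≫ e.hom) = φ := by
    rw [Functor.map_comp, homologyFunctor_map_Q_map, Iso.trans_hom, Iso.symm_hom, Iso.symm_hom]
    simp only [Category.assoc, Iso.inv_hom_id_assoc]
    rw [reassoc_of% hg, reassoc_of% hψ, Iso.hom_inv_id_assoc,
      ← Functor.map_comp, e.inv_hom_id, CategoryTheory.Functor.map_id, Category.comp_id]
  exact ⟨_, _, main⟩

theorem isZero_homologyFunctor_shift_iff (X : DerivedCategory.Bounded C) (n m a : ℤ)
    (h : n + m = a) :
    IsZero ((DerivedCategory.homologyFunctor C m).obj (X⟦n⟧).obj) ↔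
      IsZero ((DerivedCategory.homologyFunctor C a).obj X.obj) := by
  let e : (X⟦n⟧).obj ≅ X.obj⟦n⟧ := (DerivedCategory.Bounded.ι.commShiftIso n).app X
  let e' : (DerivedCategory.homologyFunctor C m).obj (X.obj⟦n⟧) ≅
      (DerivedCategory.homologyFunctor C a).obj X.obj :=
    ((DerivedCategory.homologyFunctor C 0).shiftIso n m a h).app X.obj
  exact ((DerivedCategory.homologyFunctor C m).mapIso e ≪≫ e').isZero_iff

/-- A projective generator detects cohomology. -/
theorem detectsCohomology_stalk (P : C) [Projective P]
    (hP : ∀ M : C, (∀ f : P ⟶ M, f = 0) → IsZero M) : DetectsCohomology (stalk P) := by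
  intro X n
  rw [← isZero_homologyFunctor_shift_iff X n 0 n (add_zero n)]
  constructor
  · intro h f
    exact ObjectProperty.hom_ext _ (eq_zero_of_isZero_homology P 0 _ h f.hom)
  · intro h
    refine hP _ fun φ => ?_
    obtain ⟨e, f, rfl⟩ := exists_homologyFunctor_map_eq P 0 (X⟦n⟧).obj φ
    have hf : f = 0 := congrArg (fun g => g.hom) (h (ObjectProperty.homMk f))
    rw [hf, Functor.map_zero, comp_zero]

end Projective

/-! ### Finite generation of Hom groups and existence of approximations. -/

section HomFinite

variable {C : Type u} [Category.{v} C] [Abelian C] [HasDerivedCategory.{w} C]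
  {k : Type u'} [CommRing k] [IsNoetherianRing k] [Linear k C]

/-- These morphisms form a quotient of the chain maps, which embed into the Hom group in the single
degree `n`; `k` is noetherian. -/
theorem finite_hom_single (hfin : ∀ M N : C, Module.Finite k (M ⟶ N))
    (P : C) [Projective P] (n : ℤ) (X : DerivedCategory C) :
    Module.Finite k ((DerivedCategory.singleFunctor C n).obj P ⟶ X) := by
  obtain ⟨K, ⟨e⟩⟩ : ∃ K, Nonempty (DerivedCategory.Q.obj K ≅ X) :=
    ⟨_, ⟨DerivedCategory.Q.objObjPreimageIso X⟩⟩
  let S := (CochainComplex.singleFunctor C n).obj P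
  let ev : (S ⟶ K) →ₗ[k] (S.X n ⟶ K.X n) :=
    { toFun := fun f => f.f n
      map_add' := fun _ _ => rfl
      map_smul' := fun _ _ => rfl }
  have hev : Function.Injective ev := fun f g hfg => by
    ext i
    by_cases hi : i = n
    · subst hi
      exact hfg
    · exact (HomologicalComplex.isZero_single_obj_X _ n P i hi).eq_of_src _ _
  have := hfin (S.X n) (K.X n)
  have : Module.Finite k (S ⟶ K) := Module.Finite.of_injective ev hev
  let q : (S ⟶ K) →ₗ[k] (DerivedCategory.Q.obj S ⟶ X) :=
    { toFun := fun f => DerivedCategory.Q.map f ≫ e.hom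
      map_add' := fun _ _ => by rw [Functor.map_add, Preadditive.add_comp]
      map_smul' := fun _ _ => by
        rw [Functor.map_smul, Linear.smul_comp, RingHom.id_apply] }
  refine Module.Finite.of_surjective q fun f => ?_
  obtain ⟨g, hg⟩ := exists_Q_map_eq_of_isKProjective (K := S) (f ≫ e.inv)
  refine ⟨g, ?_⟩
  change DerivedCategory.Q.map g ≫ e.hom = f
  rw [hg]
  exact (Category.assoc _ _ _).trans (by rw [e.inv_hom_id]; exact Category.comp_id _)

/-- Induction on the overlap `n` of the ranges of `X` and `Y`: covering the top cohomology of `X` by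
a shifted projective leaves a cone with smaller overlap. For `n = 0` all morphisms vanish by the
t-structure. -/
theorem finite_hom_of_isLE_of_isGE [EnoughProjectives C]
    (hfin : ∀ M N : C, Module.Finite k (M ⟶ N))
    (Y : DerivedCategory C) (a : ℤ) [Y.IsGE a] (n : ℕ) :
    ∀ (X : DerivedCategory C) (_ : X.IsLE (a + n - 1)), Module.Finite k (X ⟶ Y) := by
  induction n with
  | zero =>
    intro X hX
    have hX' : X.IsLE (a - 1) := by simpa using hX
    have : Subsingleton (X ⟶ Y) := ⟨fun f g => by
      rw [DerivedCategory.TStructure.t.zero f (a - 1) a (by lia),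
        DerivedCategory.TStructure.t.zero g (a - 1) a (by lia)]⟩
    infer_instance
  | succ n ih =>
    intro X hX
    obtain ⟨b, hb⟩ : ∃ b, b = a + n := ⟨_, rfl⟩
    have hXb : X.IsLE b := by convert hX using 1; push_cast; lia
    let H := (DerivedCategory.homologyFunctor C b).obj X
    obtain ⟨e, f, hf⟩ := exists_homologyFunctor_map_eq (Projective.over H) b X (Projective.π H)
    obtain ⟨Z, g, h, hT⟩ := distinguished_cocone_triangle f
    have hZ : Z.IsLE (a + n - 1) := by
      rw [DerivedCategory.isLE_iff]
      intro i hi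
      have hS : IsZero ((DerivedCategory.homologyFunctor C (i + 1)).obj
          ((DerivedCategory.singleFunctor C b).obj (Projective.over H))) :=
        DerivedCategory.isZero_of_isLE _ b _ (by lia)
      -- In degree `b` this holds because `f` is onto the top cohomology, above `b` because `X` has
      -- none there.
      have hg : (DerivedCategory.homologyFunctor C i).map g = 0 := by
        obtain rfl | hib : i = b ∨ b < i := by lia
        · refine (DerivedCategory.HomologySequence.epi_homologyMap_mor₁_iff _ hT i).1 ?_
          have : Epi (e.hom ≫ (DerivedCategory.homologyFunctor C i).map f) := by
            rw [hf]; infer_instance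
          exact epi_of_epi e.hom ((DerivedCategory.homologyFunctor C i).map f)
        · exact (DerivedCategory.isZero_of_isLE X b i hib).eq_of_src _ _
      exact (DerivedCategory.HomologySequence.exact₃ _ hT i (i + 1) rfl).isZero_of_both_zeros hg
        (hS.eq_of_tgt _ _)
    have := ih Z hZ
    have := finite_hom_single hfin (Projective.over H) b Y
    have := isNoetherian_of_isNoetherianRing_of_finite k (Z ⟶ Y)
    have := isNoetherian_of_isNoetherianRing_of_finite k
      ((DerivedCategory.singleFunctor C b).obj (Projective.over H) ⟶ Y)
    have := isNoetherian_of_range_eq_ker (Linear.leftComp k Y g) (Linear.leftComp k Y f) (by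
      ext φ
      constructor
      · rintro ⟨ψ, rfl⟩
        have : f ≫ g = 0 := comp_distTriang_mor_zero₁₂ _ hT
        simp [reassoc_of% this]
      · intro hφ
        obtain ⟨ψ, hψ⟩ : ∃ ψ : Z ⟶ Y, φ = g ≫ ψ := Triangle.yoneda_exact₂ _ hT φ hφ
        exact ⟨ψ, hψ.symm⟩)
    infer_instance

theorem exists_finite_generation [EnoughProjectives C]
    (hfin : ∀ M N : C, Module.Finite k (M ⟶ N))
    (X Y : DerivedCategory.Bounded C) :
    ∃ (n : ℕ) (e : Fin n → (X ⟶ Y)), ∀ f : X ⟶ Y, ∃ c : Fin n → k,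
      f.hom = ∑ i, c i • (e i).hom := by
  obtain ⟨X, -, ⟨b, hb⟩⟩ := X
  obtain ⟨Y, ⟨a, ha⟩, hY⟩ := Y
  -- `toNat` also covers `b < a`, where the overlap is `0`.
  have hX : X.IsLE (a + (b + 1 - a).toNat - 1) :=
    DerivedCategory.TStructure.t.isLE_of_le X b _ (by lia)
  have := finite_hom_of_isLE_of_isGE hfin Y a (b + 1 - a).toNat X hX
  obtain ⟨n, e, he⟩ := Module.Finite.exists_fin (R := k) (M := X ⟶ Y)
  refine ⟨n, fun i => ObjectProperty.homMk (e i), fun f => ?_⟩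
  have hf : f.hom ∈ Submodule.span k (Set.range e) := he ▸ Submodule.mem_top
  obtain ⟨c, hc⟩ := (Submodule.mem_span_range_iff_exists_fun k).1 hf
  exact ⟨c, hc.symm⟩

theorem addClosure_biproduct (T : DerivedCategory.Bounded C) (n : ℕ) :
    addClosure T (⨁ fun _ : Fin n => T) :=
  addClosure_of_sum_eq_id (fun i => biproduct.π _ i) (fun i => biproduct.ι (fun _ : Fin n => T) i)
    biproduct.total

/-- Finitely many generators of Hom(T, Y) over `k` form one morphism from a power of `T`. Scalars
act through multiples of the identity of `T`. -/
theorem exists_isRightApproximation [EnoughProjectives C]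
    (hfin : ∀ M N : C, Module.Finite k (M ⟶ N))
    (T Y : DerivedCategory.Bounded C) :
    ∃ (N : _) (f : N ⟶ Y), IsRightApproximation T f := by
  obtain ⟨n, e, he⟩ := exists_finite_generation hfin T Y
  refine ⟨⨁ fun _ : Fin n => T, biproduct.desc e, addClosure_biproduct T n, fun g => ?_⟩
  obtain ⟨c, hc⟩ := he g
  refine ⟨biproduct.lift fun i => ObjectProperty.homMk (c i • 𝟙 T.obj), ?_⟩
  rw [biproduct.lift_desc]
  refine ObjectProperty.hom_ext _ (Eq.trans ?_ hc.symm)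
  refine (map_sum (DerivedCategory.Bounded.ι (C := C)).mapAddHom _ _).trans ?_
  refine Finset.sum_congr rfl fun i _ => ?_
  exact (Linear.smul_comp _ _ _ _ _ _).trans (by rw [Category.id_comp])

theorem exists_isLeftApproximation [EnoughProjectives C]
    (hfin : ∀ M N : C, Module.Finite k (M ⟶ N))
    (T Y : DerivedCategory.Bounded C) :
    ∃ (N : _) (f : Y ⟶ N), IsLeftApproximation T f := by
  obtain ⟨n, e, he⟩ := exists_finite_generation hfin Y T
  refine ⟨⨁ fun _ : Fin n => T, biproduct.lift e, addClosure_biproduct T n, fun g => ?_⟩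
  obtain ⟨c, hc⟩ := he g
  refine ⟨biproduct.desc fun i => ObjectProperty.homMk (c i • 𝟙 T.obj), ?_⟩
  rw [biproduct.lift_desc]
  refine ObjectProperty.hom_ext _ (Eq.trans ?_ hc.symm)
  refine (map_sum (DerivedCategory.Bounded.ι (C := C)).mapAddHom _ _).trans ?_
  refine Finset.sum_congr rfl fun i _ => ?_
  exact (Linear.comp_smul _ _ _ _ _ _).trans (by rw [Category.comp_id])

end HomFinite

/-! ### Finitely generated modules: projectives, linearity, finiteness, approximations. -/

section FG

variable {A : Type u} [Ring A]

theorem isZero_of_forall_hom_eq_zero (M : FGModuleCat.{u} A)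
    (h : ∀ f : FGModuleCat.of A A ⟶ M, f = 0) : IsZero M := by
  rw [IsZero.iff_id_eq_zero]
  ext x
  have := h (FGModuleCat.ofHom (LinearMap.toSpanSingleton A M x))
  have h₂ := congrArg (fun g => g.hom.hom (1 : A)) this
  exact (one_smul A x).symm.trans h₂

variable [IsNoetherianRing A]

theorem surjective_of_epi {M N : FGModuleCat.{u} A} (f : M ⟶ N) [Epi f] :
    Function.Surjective f.hom.hom := by
  have : Epi ((forget₂ (FGModuleCat.{u} A) (ModuleCat.{u} A)).map f) := inferInstance
  exact (ModuleCat.epi_iff_surjective _).1 this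

theorem epi_of_surjective {M N : FGModuleCat.{u} A} (f : M ⟶ N)
    (hf : Function.Surjective f.hom.hom) : Epi f := by
  have : Epi ((forget₂ (FGModuleCat.{u} A) (ModuleCat.{u} A)).map f) :=
    (ModuleCat.epi_iff_surjective _).2 hf
  exact (forget₂ (FGModuleCat.{u} A) (ModuleCat.{u} A)).epi_of_epi_map this

instance projective_of (P : Type u) [AddCommGroup P] [Module A P] [Module.Finite A P]
    [Module.Projective A P] : Projective (FGModuleCat.of A P) where
  factors {M N} f e _ := by
    obtain ⟨g, hg⟩ := Module.projective_lifting_property e.hom.hom f.hom.hom (surjective_of_epi e)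
    exact ⟨FGModuleCat.ofHom g, FGModuleCat.hom_ext hg⟩

instance enoughProjectives : EnoughProjectives (FGModuleCat.{u} A) where
  presentation M := by
    obtain ⟨n, f, hf⟩ := Module.Finite.exists_fin' A M
    exact ⟨{
      p := FGModuleCat.of A (Fin n → A)
      f := FGModuleCat.ofHom f
      epi := epi_of_surjective _ hf }⟩

theorem detectsCohomology_regular [HasDerivedCategory.{w} (FGModuleCat.{u} A)] :
    DetectsCohomology (stalk (FGModuleCat.of A A)) :=
  detectsCohomology_stalk _ isZero_of_forall_hom_eq_zero

end FG

section Linear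

variable (k R : Type u) [CommRing k] [Ring R] [Algebra k R] [IsArtinAlgebra k R]

open scoped ModuleCat.Algebra in
/-- Finitely generated modules over a `k`-algebra form a `k`-linear category. -/
@[reducible]
noncomputable def linearFGModuleCat : Linear k (FGModuleCat.{u} R) :=
  inferInstanceAs (Linear k (ModuleCat.isFG.{u} R).FullSubcategory)

/-- A morphism is determined by its values on finitely many generators of `M`, so the Hom group
embeds into a power of `N`. -/
theorem finite_hom_fgModuleCat (M N : FGModuleCat.{u} R) :
    letI := linearFGModuleCat k R
    Module.Finite k (M ⟶ N) := by
  let := linearFGModuleCat k R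
  have := IsArtinAlgebra.isArtinianRing (k := k) (R := R)
  have := IsArtinAlgebra.finite (k := k) (R := R)
  let _ : Module k N := Module.restrictScalars k R N
  have : IsScalarTower k R N := IsScalarTower.restrictScalars k R N
  have : Module.Finite k N := Module.Finite.trans R N
  obtain ⟨n, s, hs⟩ := Module.Finite.exists_fin (R := R) (M := M)
  let ev : (M ⟶ N) →ₗ[k] (Fin n → N) :=
    { toFun := fun f i => f.hom.hom (s i)
      map_add' := fun _ _ => rfl
      map_smul' := fun _ _ => rfl }
  refine Module.Finite.of_injective ev fun f g hfg => ?_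
  refine FGModuleCat.hom_ext (LinearMap.ext_on_range hs fun i => ?_)
  exact congrFun hfg i

end Linear

theorem exists_isRightApproximation_fgModuleCat (k R : Type u) [CommRing k] [Ring R]
    [Algebra k R] [IsArtinAlgebra k R] [HasDerivedCategory.{w} (FGModuleCat.{u} R)]
    (T Y : DerivedCategory.Bounded (FGModuleCat.{u} R)) :
    ∃ (N : _) (f : N ⟶ Y), IsRightApproximation T f := by
  let := linearFGModuleCat k R
  have := IsArtinAlgebra.isArtinianRing (k := k) (R := R)
  exact exists_isRightApproximation (k := k) (finite_hom_fgModuleCat k R) T Y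

theorem exists_isLeftApproximation_fgModuleCat (k R : Type u) [CommRing k] [Ring R]
    [Algebra k R] [IsArtinAlgebra k R] [HasDerivedCategory.{w} (FGModuleCat.{u} R)]
    (T Y : DerivedCategory.Bounded (FGModuleCat.{u} R)) :
    ∃ (N : _) (f : Y ⟶ N), IsLeftApproximation T f := by
  let := linearFGModuleCat k R
  have := IsArtinAlgebra.isArtinianRing (k := k) (R := R)
  exact exists_isLeftApproximation (k := k) (finite_hom_fgModuleCat k R) T Y

/-! ### Reflexivity with respect to the injective envelope of `k / rad k`. -/

section Bidual

variable {k : Type u} [CommRing k] [IsArtinianRing k]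

/-- In an artinian ring, there is an element which is `1` modulo a given maximal ideal and belongs
to all other ones. -/
theorem exists_isolating_element (p : Ideal k) [hp : p.IsMaximal] :
    ∃ e : k, e ∉ p ∧ 1 - e ∈ p ∧ ∀ q ∈ p, q * e ∈ Ring.jacobson k := by
  have hfin := IsArtinianRing.setOfPred_isMaximal_finite k
  let s : Finset (Ideal k) := hfin.toFinset.erase p
  have hs : ∀ m, m ∈ s ↔ m ≠ p ∧ m.IsMaximal := fun m => by simp [s]
  -- A prime containing a finite intersection of ideals contains one of them, which is impossible
  -- for other maximal ideals.
  have hI : ¬ s.inf id ≤ p := by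
    intro h
    obtain ⟨m, hm, hmp⟩ := (Ideal.IsPrime.inf_le' hp.isPrime).1 h
    obtain ⟨hne, hmax⟩ := (hs m).1 hm
    exact hne (hmax.eq_of_le hp.ne_top hmp)
  have htop : s.inf id ⊔ p = ⊤ :=
    hp.out.2 _ (lt_of_le_of_ne le_sup_right fun h => hI (le_sup_left.trans h.ge))
  obtain ⟨e, he, f, hf, hef⟩ := Submodule.mem_sup.1 (htop ▸ Submodule.mem_top : (1 : k) ∈ _)
  have h1e : 1 - e ∈ p := by rwa [← hef, add_sub_cancel_left]
  refine ⟨e, fun hep => hp.ne_top ((Ideal.eq_top_iff_one p).2 (hef ▸ p.add_mem hep hf)), h1e,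
    fun q hq => ?_⟩
  rw [Ring.jacobson_eq_sInf_isMaximal, Submodule.mem_sInf]
  intro m hm
  by_cases hmp : m = p
  · exact hmp ▸ p.mul_mem_right e hq
  · exact Ideal.mul_mem_left m q ((Finset.inf_le ((hs m).2 ⟨hmp, hm⟩) : s.inf id ≤ m) he)

/-- The `p`-torsion of the dualizing module is one-dimensional over `k / p`: by essentiality it lies
in `k / rad k`, where the isolating element of `p` generates it. This is reflexivity for the simple
module `k / p`. -/
theorem exists_cyclic_generator (p : Ideal k) [hp : p.IsMaximal] :
    ∃ y₀ : dualizingModule k, (∀ c : k, c • y₀ = 0 ↔ c ∈ p) ∧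
      ∀ y : dualizingModule k, (∀ q ∈ p, q • y = 0) → ∃ c : k, y = c • y₀ := by
  obtain ⟨i, hi⟩ := dualizingModule_spec k
  obtain ⟨e, hep, h1e, hqe⟩ := exists_isolating_element p
  have hJp : Ring.jacobson k ≤ p := by
    rw [Ring.jacobson_eq_sInf_isMaximal]
    exact sInf_le hp
  have hmk : ∀ c : k, c • i (Ideal.Quotient.mk _ e) = i (Ideal.Quotient.mk _ (c * e)) := by
    intro c
    rw [← map_smul]
    rfl
  refine ⟨i (Ideal.Quotient.mk _ e), fun c => ?_, fun y hy => ?_⟩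
  · rw [hmk, map_eq_zero_iff i hi.injective, Ideal.Quotient.eq_zero_iff_mem]
    exact ⟨fun h => (hp.isPrime.mem_or_mem (hJp h)).resolve_right hep, fun h => hqe c h⟩
  · have hrange : y ∈ LinearMap.range i := by
      by_contra hyi
      have hbot := hi.essential (Submodule.span k {y}) (by
        rw [Submodule.eq_bot_iff]
        rintro z ⟨hz, hzi⟩
        obtain ⟨c, rfl⟩ := Submodule.mem_span_singleton.1 hz
        by_cases hc : c ∈ p
        · exact hy c hc
        · obtain ⟨d, q, hq, hdq⟩ := hp.exists_inv hc
          have : y = d • c • y := by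
            rw [smul_smul, eq_sub_of_add_eq hdq, sub_smul, one_smul, hy q hq, sub_zero]
          exact absurd (this ▸ Submodule.smul_mem _ d hzi) hyi)
      rw [Submodule.span_singleton_eq_bot] at hbot
      exact hyi (hbot ▸ Submodule.zero_mem _)
    obtain ⟨x, rfl⟩ := hrange
    obtain ⟨r, rfl⟩ := Ideal.Quotient.mk_surjective x
    refine ⟨r, ?_⟩
    -- As `1 - e ∈ p` kills `y`, `y` equals `e • y`, a multiple of the generator.
    have h0 := hy _ h1e
    rw [← map_smul] at h0
    rw [hmk, ← sub_eq_zero, ← map_sub, ← map_sub]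
    convert h0 using 2
    change _ = Ideal.Quotient.mk _ ((1 - e) * r)
    congr 1
    ring

/-- Finitely generated modules over a commutative artinian ring are reflexive with respect to the
dualizing module. -/
theorem bijective_eval_dualizingModule (N : Type u) [AddCommGroup N] [Module k N]
    [Module.Finite k N] :
    Function.Bijective (LinearMap.applyₗ : N →ₗ[k] (N →ₗ[k] dualizingModule k) →ₗ[k] _) := by
  induction ‹Module.Finite k N› using
    IsNoetherianRing.induction_on_isQuotientEquivQuotientPrime k with
  | subsingleton N =>
    have : Subsingleton (N →ₗ[k] dualizingModule k) := ⟨fun f g => by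
      ext x
      rw [Subsingleton.elim x 0, map_zero, map_zero]⟩
    refine ⟨fun x y _ => Subsingleton.elim x y, fun Φ => ⟨0, ?_⟩⟩
    ext f
    rw [Subsingleton.elim f 0, map_zero, map_zero]
  | quotient N p e =>
    have hmax : p.1.IsMaximal := inferInstance
    obtain ⟨y₀, hy₀, hy⟩ := exists_cyclic_generator p.1
    have hgen : ∀ x : N, ∃ c : k, x = c • e.symm 1 := fun x => by
      obtain ⟨c, hc⟩ := Ideal.Quotient.mk_surjective (e x)
      refine ⟨c, e.injective ?_⟩
      rw [map_smul, e.apply_symm_apply, ← hc, Algebra.smul_def, mul_one]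
      rfl
    have hp0 : ∀ q ∈ p.1, q • e.symm 1 = 0 := fun q hq => by
      rw [← map_smul, Algebra.smul_def, mul_one]
      rw [show algebraMap k (k ⧸ p.1) q = 0 from Ideal.Quotient.eq_zero_iff_mem.2 hq, map_zero]
    have hle : p.1 ≤ LinearMap.ker (LinearMap.toSpanSingleton k _ y₀) := fun c hc => (hy₀ c).2 hc
    let φ₀ : N →ₗ[k] dualizingModule k :=
      Submodule.liftQ p.1 (LinearMap.toSpanSingleton k _ y₀) hle ∘ₗ e.toLinearMap
    have hφ₀ : φ₀ (e.symm 1) = y₀ := by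
      change Submodule.liftQ p.1 (LinearMap.toSpanSingleton k _ y₀) hle (e (e.symm 1)) = y₀
      rw [e.apply_symm_apply]
      exact one_smul k y₀
    have hφ : ∀ φ : N →ₗ[k] dualizingModule k, ∃ c : k, φ = c • φ₀ := fun φ => by
      obtain ⟨c, hc⟩ := hy (φ (e.symm 1)) fun q hq => by rw [← map_smul, hp0 q hq, map_zero]
      refine ⟨c, LinearMap.ext fun x => ?_⟩
      obtain ⟨d, rfl⟩ := hgen x
      rw [map_smul, map_smul, hc, LinearMap.smul_apply, hφ₀]
    constructor
    · rw [injective_iff_map_eq_zero]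
      intro x hx
      obtain ⟨c, rfl⟩ := hgen x
      have h0 := LinearMap.congr_fun hx φ₀
      rw [LinearMap.applyₗ_apply_apply, map_smul, hφ₀, LinearMap.zero_apply, hy₀] at h0
      exact hp0 c h0
    · intro Φ
      obtain ⟨c, hc⟩ := hy (Φ φ₀) fun q hq => by
        have : q • φ₀ = 0 := LinearMap.ext fun x => by
          obtain ⟨d, rfl⟩ := hgen x
          rw [LinearMap.smul_apply, map_smul, hφ₀, smul_comm, (hy₀ q).2 hq, smul_zero,
            LinearMap.zero_apply]
        rw [← map_smul, this, map_zero]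
      refine ⟨c • e.symm 1, LinearMap.ext fun φ => ?_⟩
      obtain ⟨d, rfl⟩ := hφ φ
      rw [LinearMap.applyₗ_apply_apply, map_smul, map_smul, LinearMap.smul_apply, hφ₀, hc,
        smul_comm]
  | exact N₁ N₂ N₃ f g hf hg hfg h₁ h₃ =>
    obtain ⟨i, hi⟩ := dualizingModule_spec k
    have hext : ∀ φ : N₁ →ₗ[k] dualizingModule k, ∃ ψ : N₂ →ₗ[k] dualizingModule k, ψ ∘ₗ f = φ :=
      fun φ => by
        obtain ⟨ψ, hψ⟩ := hi.injective_module.out f hf φ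
        exact ⟨ψ, LinearMap.ext hψ⟩
    constructor
    · rw [injective_iff_map_eq_zero]
      intro x hx
      have hx' : ∀ φ : N₂ →ₗ[k] dualizingModule k, φ x = 0 := LinearMap.congr_fun hx
      have hgx : g x = 0 := h₃.1 (LinearMap.ext fun φ => by
        rw [map_zero]; exact hx' (φ ∘ₗ g))
      obtain ⟨y, rfl⟩ := (hfg x).1 hgx
      have hy : y = 0 := h₁.1 (LinearMap.ext fun φ => by
        obtain ⟨ψ, rfl⟩ := hext φ
        rw [map_zero]; exact hx' ψ)
      rw [hy, map_zero]
    · intro Φ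
      obtain ⟨z, hz⟩ := h₃.2 (Φ ∘ₗ LinearMap.lcomp k _ g)
      obtain ⟨x, rfl⟩ := hg z
      -- After subtracting evaluation at `x`, the functional vanishes on maps factoring through `g`.
      -- It thus descends to the dual of `N₁`, where it is evaluation at some `y`; the answer is `x
      -- + f y`.
      let Φ' : (N₂ →ₗ[k] dualizingModule k) →ₗ[k] dualizingModule k := Φ - LinearMap.applyₗ x
      let r : (N₂ →ₗ[k] dualizingModule k) →ₗ[k] (N₁ →ₗ[k] dualizingModule k) :=
        LinearMap.lcomp k _ f
      have hr : Function.Surjective r := hext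
      have hker : LinearMap.ker r ≤ LinearMap.ker Φ' := by
        intro ψ hψ
        obtain ⟨χ, rfl⟩ := (LinearMap.exact_lcomp_of_exact_of_surjective
          (dualizingModule k) hfg hg ψ).1 hψ
        have := LinearMap.congr_fun hz χ
        rw [LinearMap.mem_ker, LinearMap.sub_apply, sub_eq_zero]
        exact this.symm
      obtain ⟨y, hy⟩ := h₁.2 ((LinearMap.ker r).liftQ Φ' hker ∘ₗ
        (r.quotKerEquivOfSurjective hr).symm.toLinearMap)
      refine ⟨x + f y, LinearMap.ext fun ψ => ?_⟩
      have h := LinearMap.congr_fun hy (r ψ)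
      have hsymm : (r.quotKerEquivOfSurjective hr).symm (r ψ) = (LinearMap.ker r).mkQ ψ := by
        rw [LinearEquiv.symm_apply_eq]
        rfl
      rw [LinearMap.comp_apply, LinearEquiv.coe_coe, hsymm] at h
      have h' : ψ (f y) = Φ ψ - ψ x := h
      rw [LinearMap.applyₗ_apply_apply, map_add, h', add_sub_cancel]

end Bidual

open Opposite

/-! ### The module duality is an equivalence, and `D(DR)` is the regular module. -/

section Reflexive

variable {k R S : Type u} [CommRing k] [Ring R] [Algebra k R] [Ring S] [Algebra k S]

/-- The evaluation map from a module to its bidual. -/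
noncomputable def evalBidual (σ : S ≃ₐ[k] Rᵐᵒᵖ) (τ : R ≃ₐ[k] Sᵐᵒᵖ)
    (h : ∀ r : R, σ (τ r).unop = MulOpposite.op r) (M : Type u) [AddCommGroup M] [Module R M] :
    M →ₗ[R] DualModule τ (DualModule σ M) where
  toFun x := (show RestrictScalars k S (DualModule σ M) →ₗ[k] dualizingModule k from
    { toFun := fun f => (show DualModule σ M from f) x
      map_add' := fun _ _ => rfl
      map_smul' := fun c f => by
        change (show DualModule σ M from f) ((σ (algebraMap k S c)).unop • x) = _
        rw [AlgEquiv.commutes, MulOpposite.algebraMap_apply, MulOpposite.unop_op,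
          DualModule.map_algebraMap_smul, RingHom.id_apply] })
  map_add' x y := DualModule.ext τ fun f => map_add f x y
  map_smul' r x := DualModule.ext τ fun f => by
    change f (r • x) = ((τ r).unop • f) x
    rw [DualModule.smul_apply, h, MulOpposite.unop_op]

theorem bijective_evalBidual (σ : S ≃ₐ[k] Rᵐᵒᵖ) (τ : R ≃ₐ[k] Sᵐᵒᵖ)
    (h : ∀ r : R, σ (τ r).unop = MulOpposite.op r)
    [IsArtinAlgebra k R] (M : Type u) [AddCommGroup M] [Module R M]
    [Module.Finite R M] : Function.Bijective (evalBidual σ τ h M) := by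
  have := IsArtinAlgebra.isArtinianRing (k := k) (R := R)
  have := IsArtinAlgebra.finite (k := k) (R := R)
  let _ : Module k M := Module.restrictScalars k R M
  have : IsScalarTower k R M := IsScalarTower.restrictScalars k R M
  have : Module.Finite k M := Module.Finite.trans R M
  obtain ⟨hinj, hsurj⟩ := bijective_eval_dualizingModule (k := k) M
  constructor
  · intro x y hxy
    exact hinj (LinearMap.ext fun f => DFunLike.congr_fun hxy (show DualModule σ M from f))
  · intro Φ
    let Φ' : (M →ₗ[k] dualizingModule k) →ₗ[k] dualizingModule k :=
      { toFun := fun f => Φ (show DualModule σ M from f)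
        map_add' := fun f g => map_add Φ (show DualModule σ M from f) (show DualModule σ M from g)
        map_smul' := fun c f => by
          rw [RingHom.id_apply, ← DualModule.map_algebraMap_smul]
          exact congrArg Φ (algebraMap_smul S c (show DualModule σ M from f)).symm }
    obtain ⟨x, hx⟩ := hsurj Φ'
    exact ⟨x, DualModule.ext τ fun f => LinearMap.congr_fun hx f⟩

/-- A finitely generated module is isomorphic to its bidual. -/
noncomputable def bidualIso (σ : S ≃ₐ[k] Rᵐᵒᵖ) (τ : R ≃ₐ[k] Sᵐᵒᵖ)
    (h : ∀ r : R, σ (τ r).unop = MulOpposite.op r)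
    [IsArtinAlgebra k R] [IsArtinAlgebra k S] (M : FGModuleCat.{u} R) :
    M ≅ (dualFunctor τ).obj (op ((dualFunctor σ).obj (op M))) :=
  (LinearEquiv.ofBijective (evalBidual σ τ h M)
    (bijective_evalBidual σ τ h M)).toFGModuleCatIso

theorem isEquivalence_dualFunctor (σ : S ≃ₐ[k] Rᵐᵒᵖ) (τ : R ≃ₐ[k] Sᵐᵒᵖ)
    (h : ∀ r : R, σ (τ r).unop = MulOpposite.op r)
    [IsArtinAlgebra k R] [IsArtinAlgebra k S] :
    (dualFunctor (R := R) σ).IsEquivalence where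
  faithful := ⟨fun {M N f g} hfg => by
    refine Quiver.Hom.unop_inj (FGModuleCat.hom_ext (LinearMap.ext fun x => ?_))
    refine (bijective_evalBidual σ τ h M.unop).1 (DualModule.ext τ fun φ => ?_)
    have := congrArg (fun u => u.hom.hom φ) hfg
    exact DFunLike.congr_fun (F := DualModule σ _) this x⟩
  full := ⟨fun {M N} u => by
    let E := LinearEquiv.ofBijective _ (bijective_evalBidual σ τ h M.unop)
    -- The only candidate for a preimage: the dual of `u`, conjugated by the evaluation
    -- isomorphisms.
    let f : N.unop →ₗ[R] M.unop :=
      E.symm.toLinearMap ∘ₗ DualModule.map τ u.hom.hom ∘ₗ evalBidual σ τ h N.unop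
    refine ⟨(FGModuleCat.ofHom f).op, FGModuleCat.hom_ext (LinearMap.ext fun φ => ?_)⟩
    refine DualModule.ext σ fun y => ?_
    have hf : evalBidual σ τ h M.unop (f y) =
        DualModule.map τ u.hom.hom (evalBidual σ τ h N.unop y) :=
      E.apply_symm_apply _
    exact DFunLike.congr_fun hf φ⟩
  essSurj := ⟨fun N => by
    have h' : ∀ s : S, τ (σ s).unop = MulOpposite.op s := fun s => by
      have := h ((σ s).unop)
      rw [MulOpposite.op_unop] at this
      exact MulOpposite.unop_injective (σ.injective this)
    exact ⟨op ((dualFunctor τ).obj (op N)), ⟨(bidualIso τ σ h' N).symm⟩⟩⟩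

end Reflexive

section Regular

variable (k R : Type u) [CommRing k] [Ring R] [Algebra k R] [IsArtinAlgebra k R]

instance isEquivalence_dualFunctor_refl :
    (dualFunctor (R := R) (AlgEquiv.refl : Rᵐᵒᵖ ≃ₐ[k] Rᵐᵒᵖ)).IsEquivalence :=
  isEquivalence_dualFunctor AlgEquiv.refl (AlgEquiv.opOp k R) fun _ => rfl

/-- The dual of `DR` is the right regular module. -/
noncomputable def dualDualRegularIso : (dualFunctor (AlgEquiv.refl : Rᵐᵒᵖ ≃ₐ[k] Rᵐᵒᵖ)).obj
    (op (dualRegular k R)) ≅ FGModuleCat.of Rᵐᵒᵖ Rᵐᵒᵖ :=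
  (bidualIso (AlgEquiv.opOp k R) (AlgEquiv.refl : Rᵐᵒᵖ ≃ₐ[k] Rᵐᵒᵖ) (fun _ => rfl) _).symm

end Regular

/-! ### The duality on complexes and on derived categories. -/

section ContraMap

variable {C : Type u} [Category.{v} C] [Abelian C] {C' : Type u'} [Category.{v'} C'] [Abelian C']

theorem quasiIso_opEquivalence_map_iff {K L : CochainComplex C ℤ} (f : K ⟶ L) :
    QuasiIso ((CochainComplex.opEquivalence C).functor.map f.op) ↔ QuasiIso f := by
  refine ⟨fun hf => ?_, fun _ => quasiIso_opEquivalence_map f⟩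
  rw [quasiIso_iff] at hf ⊢
  intro n
  have h := hf (-n)
  rw [quasiIsoAt_iff' _ (-(n + 1)) (-n) (-(n - 1)) (by simp; lia) (by simp; lia)] at h
  -- Passing to the opposite negates degrees, so the indices at `-n` appear doubly negated.
  have h' := (ShortComplex.quasiIso_opMap_iff
    ((HomologicalComplex.shortComplexFunctor' C (ComplexShape.up ℤ)
      (- -(n - 1)) (- -n) (- -(n + 1))).map f)).1 h
  rw [neg_neg, neg_neg, neg_neg] at h'
  rwa [quasiIsoAt_iff' _ (n - 1) n (n + 1) (by simp) (by simp)]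

variable (F : Cᵒᵖ ⥤ C') [F.Additive]

instance [F.IsEquivalence] : (contraMapComplex F).IsEquivalence := by
  have : F.asEquivalence.functor.PreservesZeroMorphisms :=
    inferInstanceAs F.PreservesZeroMorphisms
  have : (F.mapHomologicalComplex (ComplexShape.up ℤ)).IsEquivalence :=
    inferInstanceAs (F.asEquivalence.mapHomologicalComplex
      (ComplexShape.up ℤ)).functor.IsEquivalence
  exact inferInstanceAs ((CochainComplex.opEquivalence C).functor ⋙
    F.mapHomologicalComplex (ComplexShape.up ℤ)).IsEquivalence

variable [F.IsEquivalence] [F.PreservesHomology]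

theorem quasiIso_contraMapComplex_map_iff {K L : CochainComplex C ℤ} (f : K ⟶ L) :
    QuasiIso ((contraMapComplex F).map f.op) ↔ QuasiIso f :=
  (HomologicalComplex.quasiIso_map_iff_of_preservesHomology
    ((CochainComplex.opEquivalence C).functor.map f.op) F).trans
    (quasiIso_opEquivalence_map_iff f)

theorem exactAt_contraMapComplex_iff (K : CochainComplex C ℤ) (n m : ℤ) (h : n + m = 0) :
    ((contraMapComplex F).obj (op K)).ExactAt m ↔ K.ExactAt n := by
  obtain rfl : n = -m := by lia
  rw [HomologicalComplex.exactAt_iff' _ (m - 1) m (m + 1) (by simp) (by simp),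
    HomologicalComplex.exactAt_iff' _ (-(m + 1)) (-m) (-(m - 1)) (by simp; lia) (by simp; lia)]
  exact (ShortComplex.exact_map_iff_of_faithful (K.sc' (-(m + 1)) (-m) (-(m - 1))).op F).trans
    (ShortComplex.exact_op_iff _)

/-- The functor on complexes, as a morphism of localizers for the quasi-isomorphisms. -/
def contraMapLocalizer : LocalizerMorphism
    (HomologicalComplex.quasiIso C (ComplexShape.up ℤ)).op
    (HomologicalComplex.quasiIso C' (ComplexShape.up ℤ)) where
  functor := contraMapComplex F
  map _ _ f hf := (quasiIso_contraMapComplex_map_iff F f.unop).2 hf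

instance : (contraMapLocalizer F).IsInduced where
  inverseImage_eq := by
    ext _ _ f
    exact quasiIso_contraMapComplex_map_iff F f.unop

instance : (contraMapLocalizer F).functor.IsEquivalence :=
  inferInstanceAs (contraMapComplex F).IsEquivalence

variable [HasDerivedCategory.{w} C] [HasDerivedCategory.{w'} C']

/-- An equivalence on complexes that preserves and reflects quasi-isomorphisms induces an
equivalence of localizations. -/
instance : (contraMapDerived F).IsEquivalence := by
  have := (contraMapLocalizer F).isLocalizedEquivalence_of_isInduced
  have : CatCommSq (contraMapLocalizer F).functor DerivedCategory.Q.op DerivedCategory.Q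
    (contraMapDerived F) := ⟨(contraMapDerivedFactors F).symm⟩
  exact (contraMapLocalizer F).isEquivalence DerivedCategory.Q.op DerivedCategory.Q
    (contraMapDerived F)

/-- The functor on derived categories applied to the class of a complex. -/
noncomputable def contraMapDerivedQIso (K : CochainComplex C ℤ) :
    (contraMapDerived F).obj (op (DerivedCategory.Q.obj K)) ≅
      DerivedCategory.Q.obj ((contraMapComplex F).obj (op K)) :=
  (contraMapDerivedFactors F).app (op K)

theorem isZero_homologyFunctor_Q_iff (K : CochainComplex C ℤ) (n : ℤ) :
    IsZero ((DerivedCategory.homologyFunctor C n).obj (DerivedCategory.Q.obj K)) ↔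
      K.ExactAt n := by
  rw [HomologicalComplex.exactAt_iff_isZero_homology]
  exact (homologyQIso K n).isZero_iff

theorem isZero_homologyFunctor_contraMapDerived_iff (X : DerivedCategory C) (n m : ℤ)
    (h : n + m = 0) :
    IsZero ((DerivedCategory.homologyFunctor C' m).obj ((contraMapDerived F).obj (op X))) ↔
      IsZero ((DerivedCategory.homologyFunctor C n).obj X) := by
  obtain ⟨K, ⟨e⟩⟩ : ∃ K, Nonempty (DerivedCategory.Q.obj K ≅ X) :=
    ⟨_, ⟨DerivedCategory.Q.objObjPreimageIso X⟩⟩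
  rw [← ((DerivedCategory.homologyFunctor C n).mapIso e).isZero_iff,
    isZero_homologyFunctor_Q_iff, ← exactAt_contraMapComplex_iff F K n m h,
    ← isZero_homologyFunctor_Q_iff]
  exact ((DerivedCategory.homologyFunctor C' m).mapIso
    ((contraMapDerived F).mapIso e.op ≪≫ contraMapDerivedQIso F K)).isZero_iff

instance : (contraMapBounded F).Full :=
  inferInstanceAs (ObjectProperty.lift _ (DerivedCategory.Bounded.ι.op ⋙ contraMapDerived F) _).Full

instance : (contraMapBounded F).Faithful :=
  inferInstanceAs
    (ObjectProperty.lift _ (DerivedCategory.Bounded.ι.op ⋙ contraMapDerived F) _).Faithful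

/-- Boundedness is visible on cohomology, which the duality only reindexes. It yields essential
surjectivity on bounded categories. -/
theorem bounded_of_contraMapDerived {X : DerivedCategory C}
    (h : DerivedCategory.TStructure.t.bounded ((contraMapDerived F).obj (op X))) :
    DerivedCategory.TStructure.t.bounded X := by
  obtain ⟨⟨a, ha⟩, ⟨b, hb⟩⟩ := h
  have ha : ((contraMapDerived F).obj (op X)).IsGE a := ha
  have hb : ((contraMapDerived F).obj (op X)).IsLE b := hb
  rw [DerivedCategory.isGE_iff] at ha
  rw [DerivedCategory.isLE_iff] at hb
  have h₁ : X.IsGE (-b) := by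
    rw [DerivedCategory.isGE_iff]
    exact fun i hi => (isZero_homologyFunctor_contraMapDerived_iff F X i (-i) (by lia)).1
      (hb _ (by lia))
  have h₂ : X.IsLE (-a) := by
    rw [DerivedCategory.isLE_iff]
    exact fun i hi => (isZero_homologyFunctor_contraMapDerived_iff F X i (-i) (by lia)).1
      (ha _ (by lia))
  exact ⟨⟨-b, h₁⟩, ⟨-a, h₂⟩⟩

instance : (contraMapBounded F).EssSurj where
  mem_essImage Y := by
    obtain ⟨X, ⟨e⟩⟩ : ∃ X : DerivedCategory C,
        Nonempty ((contraMapDerived F).obj (op X) ≅ Y.obj) :=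
      ⟨_, ⟨(contraMapDerived F).objObjPreimageIso Y.obj⟩⟩
    have hX := bounded_of_contraMapDerived F
      (DerivedCategory.TStructure.t.bounded.prop_of_iso e.symm Y.property)
    exact ⟨op ⟨X, hX⟩, ⟨ObjectProperty.isoMk _ e⟩⟩

instance : (contraMapBounded F).IsEquivalence where

end ContraMap

/-! ### Triangles as short exact sequences of complexes. -/

section ShortExact

variable {C : Type u} [Category.{v} C] [Abelian C] [HasDerivedCategory.{w} C]
  {X Y Z : DerivedCategory.Bounded C}

/-- The inverse rotation is isomorphic to a mapping cone triangle of some `φ : K ⟶ L`. Rotating back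
gives the degreewise split sequence L → cone(φ) → K[1]. -/
theorem exists_shortExact_of_distinguished (T : Pretriangulated.Triangle (DerivedCategory C))
    (hT : T ∈ Pretriangulated.distinguishedTriangles) :
    ∃ S : ShortComplex (CochainComplex C ℤ), S.ShortExact ∧
      Nonempty (DerivedCategory.Q.obj S.X₁ ≅ T.obj₁) ∧
      Nonempty (DerivedCategory.Q.obj S.X₂ ≅ T.obj₂) ∧
      Nonempty (DerivedCategory.Q.obj S.X₃ ≅ T.obj₃) := by
  obtain ⟨K, L, φ, ⟨e⟩⟩ := (DerivedCategory.mem_distTriang_iff _).1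
    (Pretriangulated.inv_rot_of_distTriang _ hT)
  refine ⟨CochainComplex.mappingCone.triangleRotateShortComplex φ,
    HomologicalComplex.shortExact_of_degreewise_shortExact _ fun n =>
      (CochainComplex.mappingCone.triangleRotateShortComplexSplitting φ n).shortExact,
    ⟨(Pretriangulated.Triangle.π₂.mapIso e).symm⟩,
    ⟨(Pretriangulated.Triangle.π₃.mapIso e).symm⟩,
    ⟨((DerivedCategory.Q.commShiftIso (1 : ℤ)).app K) ≪≫
      (shiftFunctor _ (1 : ℤ)).mapIso (Pretriangulated.Triangle.π₁.mapIso e).symm ≪≫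
      (shiftFunctorCompIsoId (DerivedCategory C) (-1 : ℤ) 1 (by lia)).app T.obj₃⟩⟩

theorem HasTriangle.exists_shortExact (h : HasTriangle X Y Z) :
    ∃ S : ShortComplex (CochainComplex C ℤ), S.ShortExact ∧
      Nonempty (DerivedCategory.Q.obj S.X₁ ≅ X.obj) ∧
      Nonempty (DerivedCategory.Q.obj S.X₂ ≅ Y.obj) ∧
      Nonempty (DerivedCategory.Q.obj S.X₃ ≅ Z.obj) := by
  obtain ⟨f, g, h, hT⟩ := h
  exact exists_shortExact_of_distinguished _
    (DerivedCategory.Bounded.ι.map_distinguished _ hT)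

theorem HasTriangle.of_shortExact {S : ShortComplex (CochainComplex C ℤ)} (hS : S.ShortExact)
    (e₁ : DerivedCategory.Q.obj S.X₁ ≅ X.obj) (e₂ : DerivedCategory.Q.obj S.X₂ ≅ Y.obj)
    (e₃ : DerivedCategory.Q.obj S.X₃ ≅ Z.obj) : HasTriangle X Y Z := by
  let f : X ⟶ Y := ObjectProperty.homMk (e₁.inv ≫ DerivedCategory.Q.map S.f ≫ e₂.hom)
  obtain ⟨Z', g, δ, hZ'⟩ := Pretriangulated.distinguished_cocone_triangle f
  have hf : DerivedCategory.Q.map S.f ≫ e₂.hom = e₁.hom ≫ f.hom := by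
    change _ = e₁.hom ≫ e₁.inv ≫ DerivedCategory.Q.map S.f ≫ e₂.hom
    rw [e₁.hom_inv_id_assoc]
  let e := Pretriangulated.isoTriangleOfIso₁₂ _ _
    (DerivedCategory.triangleOfSES_distinguished hS)
    (DerivedCategory.Bounded.ι.map_distinguished _ hZ') e₁ e₂ hf
  let e' : Z'.obj ≅ Z.obj := (Pretriangulated.Triangle.π₃.mapIso e).symm ≪≫ e₃
  exact HasTriangle.of_iso ⟨f, g, δ, hZ'⟩ (Iso.refl X) (Iso.refl Y) (ObjectProperty.isoMk _ e')

/-- A triangle with zero middle term characterizes the shift, so compatibility of the duality with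
shifts follows from its compatibility with triangles. -/
theorem exists_hasTriangle_shift (X : DerivedCategory.Bounded C) :
    ∃ Y, IsZero Y ∧ HasTriangle X Y (X⟦(1 : ℤ)⟧) := by
  have h := Pretriangulated.rot_of_distTriang _ (Pretriangulated.contractible_distinguished X)
  exact ⟨_, isZero_zero _, _, _, _, h⟩

theorem HasTriangle.nonempty_iso_shift (h : HasTriangle X Y Z) (hY : IsZero Y) :
    Nonempty (Z ≅ X⟦(1 : ℤ)⟧) := by
  obtain ⟨f, g, h, hT⟩ := h
  have : IsIso h := (Pretriangulated.Triangle.isZero₂_iff_isIso₃ _ hT).1 hY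
  exact ⟨asIso h⟩

end ShortExact

section ShortExactDual

variable {C : Type u} [Category.{v} C] [Abelian C] {C' : Type u'} [Category.{v'} C'] [Abelian C']
  (F : Cᵒᵖ ⥤ C') [F.Additive] [F.IsEquivalence]

theorem shortExact_contraMapComplex {S : ShortComplex (CochainComplex C ℤ)} (hS : S.ShortExact) :
    (S.op.map (contraMapComplex F)).ShortExact :=
  hS.op.map_of_exact _

/-- A short exact sequence of complexes is the image of a short exact sequence under an exact
duality. -/
theorem exists_shortExact_contraMapComplex {S : ShortComplex (CochainComplex C' ℤ)}
    (hS : S.ShortExact) : ∃ S' : ShortComplex (CochainComplex C ℤ), S'.ShortExact ∧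
      Nonempty ((contraMapComplex F).obj (op S'.X₁) ≅ S.X₃) ∧
      Nonempty ((contraMapComplex F).obj (op S'.X₂) ≅ S.X₂) ∧
      Nonempty ((contraMapComplex F).obj (op S'.X₃) ≅ S.X₁) :=
  ⟨(S.map (contraMapComplex F).inv).unop, (hS.map_of_exact (contraMapComplex F).inv).unop,
    ⟨(contraMapComplex F).asEquivalence.counitIso.app S.X₃⟩,
    ⟨(contraMapComplex F).asEquivalence.counitIso.app S.X₂⟩,
    ⟨(contraMapComplex F).asEquivalence.counitIso.app S.X₁⟩⟩

end ShortExactDual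

/-! ### Transport of triangles, shifts, Hom vanishing and `add` through the duality. -/

section Transport

variable {C : Type u} [Category.{v} C] [Abelian C] {C' : Type u'} [Category.{v'} C'] [Abelian C']
  (F : Cᵒᵖ ⥤ C') [F.Additive] [F.PreservesHomology]
  [HasDerivedCategory.{w} C] [HasDerivedCategory.{w'} C'] {X Y Z : DerivedCategory.Bounded C}

/-- The dual of an object of the derived category that is represented by a given complex. -/
noncomputable def contraMapBoundedIsoOfQIso {K : CochainComplex C ℤ}
    (e : DerivedCategory.Q.obj K ≅ X.obj) :
    DerivedCategory.Q.obj ((contraMapComplex F).obj (op K)) ≅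
      ((contraMapBounded F).obj (op X)).obj :=
  (contraMapDerivedQIso F K).symm ≪≫ (contraMapDerived F).mapIso e.symm.op

/-- The functor induced on derived categories is compatible with stalk complexes. -/
theorem nonempty_contraMapBounded_stalk_iso (M : C) :
    Nonempty ((contraMapBounded F).obj (op (stalk M)) ≅ stalk (F.obj (op M))) := by
  let K := (CochainComplex.singleFunctor C 0).obj M
  have hz : ∀ n : ℤ, n ≠ 0 → IsZero (((contraMapComplex F).obj (op K)).X n) := fun n hn =>
    F.map_isZero (HomologicalComplex.isZero_single_obj_X (ComplexShape.up ℤ) 0 M (-n)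
      (by lia)).op
  have h₁ : ((contraMapComplex F).obj (op K)).IsStrictlyGE 0 := by
    rw [CochainComplex.isStrictlyGE_iff]
    exact fun n hn => hz n (by lia)
  have h₂ : ((contraMapComplex F).obj (op K)).IsStrictlyLE 0 := by
    rw [CochainComplex.isStrictlyLE_iff]
    exact fun n hn => hz n (by lia)
  -- The dual complex lives in degree 0, hence is a stalk; its module is identified by evaluating
  -- there.
  obtain ⟨N, ⟨e⟩⟩ := ((contraMapComplex F).obj (op K)).exists_iso_single 0
  let i : F.obj (op M) ≅ N :=
    F.mapIso (HomologicalComplex.singleObjXSelf (ComplexShape.up ℤ) 0 M).op ≪≫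
      (HomologicalComplex.eval C' (ComplexShape.up ℤ) 0).mapIso e ≪≫
      HomologicalComplex.singleObjXSelf (ComplexShape.up ℤ) 0 N
  let e' := e ≪≫ (CochainComplex.singleFunctor C' 0).mapIso i.symm
  exact ⟨ObjectProperty.isoMk _ ((contraMapBoundedIsoOfQIso F (X := stalk M)
    (((DerivedCategory.singleFunctorIsoCompQ C 0).app M).symm)).symm ≪≫
    DerivedCategory.Q.mapIso e' ≪≫
    ((DerivedCategory.singleFunctorIsoCompQ C' 0).app (F.obj (op M))).symm)⟩

variable [F.IsEquivalence]

theorem exists_Q_iso_of_contraMapBounded_iso {K : CochainComplex C ℤ}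
    (e : DerivedCategory.Q.obj ((contraMapComplex F).obj (op K)) ≅
      ((contraMapBounded F).obj (op X)).obj) : Nonempty (DerivedCategory.Q.obj K ≅ X.obj) :=
  ⟨((contraMapDerived F).preimageIso
    (show (contraMapDerived F).obj (op (DerivedCategory.Q.obj K)) ≅
      (contraMapDerived F).obj (op X.obj) from contraMapDerivedQIso F K ≪≫ e)).unop.symm⟩

theorem hasTriangle_contraMapBounded_iff :
    HasTriangle ((contraMapBounded F).obj (op Z)) ((contraMapBounded F).obj (op Y))
      ((contraMapBounded F).obj (op X)) ↔ HasTriangle X Y Z := by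
  constructor
  · intro h
    obtain ⟨S, hS, ⟨e₁⟩, ⟨e₂⟩, ⟨e₃⟩⟩ := h.exists_shortExact
    obtain ⟨S', hS', ⟨e₁'⟩, ⟨e₂'⟩, ⟨e₃'⟩⟩ := exists_shortExact_contraMapComplex F hS
    obtain ⟨i₁⟩ := exists_Q_iso_of_contraMapBounded_iso F
      (DerivedCategory.Q.mapIso e₁' ≪≫ e₃)
    obtain ⟨i₂⟩ := exists_Q_iso_of_contraMapBounded_iso F
      (DerivedCategory.Q.mapIso e₂' ≪≫ e₂)
    obtain ⟨i₃⟩ := exists_Q_iso_of_contraMapBounded_iso F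
      (DerivedCategory.Q.mapIso e₃' ≪≫ e₁)
    exact HasTriangle.of_shortExact hS' i₁ i₂ i₃
  · intro h
    obtain ⟨S, hS, ⟨e₁⟩, ⟨e₂⟩, ⟨e₃⟩⟩ := h.exists_shortExact
    exact HasTriangle.of_shortExact (shortExact_contraMapComplex F hS)
      (contraMapBoundedIsoOfQIso F e₃) (contraMapBoundedIsoOfQIso F e₂)
      (contraMapBoundedIsoOfQIso F e₁)

theorem cohomologyIn_contraMapBounded_iff {a b : ℤ} :
    cohomologyIn (-b) (-a) ((contraMapBounded F).obj (op X)) ↔ cohomologyIn a b X := by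
  constructor
  · intro h n hn
    exact (isZero_homologyFunctor_contraMapDerived_iff F X.obj n (-n) (by lia)).1
      (h (-n) fun h' => hn ⟨by have := h'.2; lia, by have := h'.1; lia⟩)
  · intro h n hn
    exact (isZero_homologyFunctor_contraMapDerived_iff F X.obj (-n) n (by lia)).2
      (h (-n) fun h' => hn ⟨by have := h'.2; lia, by have := h'.1; lia⟩)

theorem nonempty_contraMapBounded_shift_one_iso (X : DerivedCategory.Bounded C) :
    Nonempty ((contraMapBounded F).obj (op X) ≅
      ((contraMapBounded F).obj (op (X⟦(1 : ℤ)⟧)))⟦(1 : ℤ)⟧) := by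
  obtain ⟨Y, hY, h⟩ := exists_hasTriangle_shift X
  exact ((hasTriangle_contraMapBounded_iff F).2 h).nonempty_iso_shift
    ((contraMapBounded F).map_isZero hY.op)

theorem nonempty_contraMapBounded_iso_shift (X : DerivedCategory.Bounded C) (n : ℤ) :
    Nonempty ((contraMapBounded F).obj (op X) ≅
      ((contraMapBounded F).obj (op (X⟦n⟧)))⟦n⟧) := by
  have key : ∀ m : ℤ, Nonempty (((contraMapBounded F).obj (op (X⟦m⟧)))⟦m⟧ ≅
      ((contraMapBounded F).obj (op (X⟦m + 1⟧)))⟦m + 1⟧) := fun m => by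
    obtain ⟨e⟩ := nonempty_contraMapBounded_shift_one_iso F (X⟦m⟧)
    let e' : (contraMapBounded F).obj (op (X⟦m⟧⟦(1 : ℤ)⟧)) ≅
        (contraMapBounded F).obj (op (X⟦m + 1⟧)) :=
      (contraMapBounded F).mapIso ((shiftFunctorAdd _ m 1).app X).op
    exact ⟨(shiftFunctor _ m).mapIso (e ≪≫ (shiftFunctor _ (1 : ℤ)).mapIso e') ≪≫
      ((shiftFunctorAdd' _ 1 m (m + 1) (by lia)).app _).symm⟩
  induction n using Int.induction_on with
  | zero =>
    exact ⟨(contraMapBounded F).mapIso ((shiftFunctorZero _ ℤ).app X).op ≪≫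
      ((shiftFunctorZero _ ℤ).app _).symm⟩
  | succ i ih =>
    obtain ⟨e⟩ := ih
    obtain ⟨e'⟩ := key i
    exact ⟨e ≪≫ e'⟩
  | pred i ih =>
    obtain ⟨e⟩ := ih
    obtain ⟨e'⟩ := key (-i - 1)
    rw [sub_add_cancel] at e'
    exact ⟨e ≪≫ e'.symm⟩

/-- Replace DY by D(Y[n])[n], cancel the shift, and use full faithfulness to reach Hom(X, Y[n]). -/
theorem homVanishes_contraMapBounded_iff {n : ℤ} :
    HomVanishes ((contraMapBounded F).obj (op Y)) ((contraMapBounded F).obj (op X)) n ↔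
      HomVanishes X Y n := by
  obtain ⟨e⟩ := nonempty_contraMapBounded_iso_shift F Y n
  have h₁ : HomVanishes ((contraMapBounded F).obj (op Y)) ((contraMapBounded F).obj (op X)) n ↔
      HomVanishes ((contraMapBounded F).obj (op (Y⟦n⟧))) ((contraMapBounded F).obj (op X)) 0 :=
    Iff.trans ⟨fun h => h.of_iso e (Iso.refl _), fun h => h.of_iso e.symm (Iso.refl _)⟩
      (HomVanishes.shift_left_iff n (by lia))
  rw [h₁]
  let i := (shiftFunctorZero _ ℤ).app ((contraMapBounded F).obj (op X))
  constructor
  · intro h f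
    have := h ((contraMapBounded F).map f.op ≫ i.inv)
    rw [← zero_comp, cancel_mono] at this
    exact Quiver.Hom.op_inj ((contraMapBounded F).map_injective
      (this.trans ((contraMapBounded F).map_zero _ _).symm))
  · intro h f
    obtain ⟨g, hg⟩ : ∃ g : X ⟶ Y⟦n⟧, (contraMapBounded F).map g.op = f ≫ i.hom :=
      ⟨((contraMapBounded F).preimage (f ≫ i.hom)).unop, (contraMapBounded F).map_preimage _⟩
    rw [← cancel_mono i.hom, ← hg, h g, zero_comp]
    exact (contraMapBounded F).map_zero _ _

instance : (contraMapBounded F).Additive :=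
  Functor.additive_of_preserves_binary_products _

theorem addClosure_contraMapBounded_iff :
    addClosure ((contraMapBounded F).obj (op X)) ((contraMapBounded F).obj (op Y)) ↔
      addClosure X Y := by
  constructor
  · intro h
    obtain ⟨n, f, g, hfg⟩ := exists_sum_eq_id_of_addClosure h
    refine addClosure_of_sum_eq_id (fun i => ((contraMapBounded F).preimage (g i)).unop)
      (fun i => ((contraMapBounded F).preimage (f i)).unop) ?_
    refine Quiver.Hom.op_inj ((contraMapBounded F).map_injective ?_)
    rw [op_sum, Functor.map_sum]
    simpa using hfg
  · intro h
    obtain ⟨n, f, g, hfg⟩ := exists_sum_eq_id_of_addClosure h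
    refine addClosure_of_sum_eq_id (fun i => (contraMapBounded F).map (g i).op)
      (fun i => (contraMapBounded F).map (f i).op) ?_
    have := congrArg (fun u => (contraMapBounded F).map u.op) hfg
    rw [op_sum, Functor.map_sum] at this
    simpa using this

end Transport

/-! ### The duality exchanges Auslander and co-Auslander classes. -/

section AuslanderTransport

variable {C : Type u} [Category.{v} C] [Abelian C] {C' : Type u'} [Category.{v'} C'] [Abelian C']
  (F : Cᵒᵖ ⥤ C') [F.Additive] [F.IsEquivalence] [F.PreservesHomology]
  [HasDerivedCategory.{w} C] [HasDerivedCategory.{w'} C']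
  {T X Y : DerivedCategory.Bounded C}

theorem leftPerp_contraMapBounded_iff :
    leftPerp ((contraMapBounded F).obj (op T)) ((contraMapBounded F).obj (op X)) ↔
      rightPerp T X :=
  forall₂_congr fun _ _ => homVanishes_contraMapBounded_iff F

theorem isSemiSelforthogonal_contraMapBounded_iff :
    IsSemiSelforthogonal ((contraMapBounded F).obj (op T)) ↔ IsSemiSelforthogonal T :=
  leftPerp_contraMapBounded_iff F

theorem leftPerp.of_iso {X' : DerivedCategory.Bounded C} (h : leftPerp T X) (e : X ≅ X') :
    leftPerp T X' :=
  fun i hi => HomVanishes.of_iso (h i hi) e (Iso.refl T)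

theorem cohomologyIn.of_iso {X' : DerivedCategory.Bounded C} {a b : ℤ} (h : cohomologyIn a b X)
    (e : X ≅ X') : cohomologyIn a b X' :=
  fun n hn => (h n hn).of_iso
    ((DerivedCategory.Bounded.ι ⋙ DerivedCategory.homologyFunctor C n).mapIso e.symm)

theorem addClosure.of_iso {X' : DerivedCategory.Bounded C} (h : addClosure T X)
    (e : X ≅ X') : addClosure T X' := by
  obtain ⟨n, N', ⟨i⟩⟩ := h
  exact ⟨n, N', ⟨biprod.mapIso e.symm (Iso.refl N') ≪≫ i⟩⟩

theorem exists_contraMapBounded_iso (Y : DerivedCategory.Bounded C') :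
    ∃ X : DerivedCategory.Bounded C, Nonempty (Y ≅ (contraMapBounded F).obj (op X)) :=
  ⟨((contraMapBounded F).objPreimage Y).unop, ⟨((contraMapBounded F).objObjPreimageIso Y).symm⟩⟩

theorem nonempty_contraMapBounded_shift_iso (X : DerivedCategory.Bounded C) (n m : ℤ)
    (h : n + m = 0) : Nonempty ((contraMapBounded F).obj (op (X⟦n⟧)) ≅
      ((contraMapBounded F).obj (op X))⟦m⟧) := by
  obtain ⟨e⟩ := nonempty_contraMapBounded_iso_shift F X n
  exact ⟨((shiftFunctor _ m).mapIso e ≪≫ (shiftFunctorCompIsoId _ n m h).app _).symm⟩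

theorem coAuslanderClass_contraMapBounded (h : auslanderClass T X) :
    coAuslanderClass ((contraMapBounded F).obj (op T)) ((contraMapBounded F).obj (op X)) := by
  obtain ⟨a, b, hT, Y, N, rfl, h⟩ := h
  refine ⟨-b, -a, (cohomologyIn_contraMapBounded_iff F).2 hT,
    fun i => (contraMapBounded F).obj (op (Y i)), fun i => (contraMapBounded F).obj (op (N i)),
    rfl, fun i => ?_⟩
  obtain ⟨h₁, h₂, h₃, h₄⟩ := h i
  exact ⟨(hasTriangle_contraMapBounded_iff F).2 h₁, (addClosure_contraMapBounded_iff F).2 h₂,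
    (leftPerp_contraMapBounded_iff F).2 h₃, (cohomologyIn_contraMapBounded_iff F).2 h₄⟩

theorem exists_auslanderClass_of_coAuslanderClass {W : DerivedCategory.Bounded C'}
    (h : coAuslanderClass ((contraMapBounded F).obj (op T)) W) :
    ∃ X, auslanderClass T X ∧ Nonempty (W ≅ (contraMapBounded F).obj (op X)) := by
  obtain ⟨a, b, hT, Y, N, rfl, h⟩ := h
  choose Y' eY using fun i => exists_contraMapBounded_iso F (Y i)
  choose N' eN using fun i => exists_contraMapBounded_iso F (N i)
  have hI : ∀ X : DerivedCategory.Bounded C, cohomologyIn a b ((contraMapBounded F).obj (op X)) →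
      cohomologyIn (-b) (-a) X := fun X hX => by
    rw [← cohomologyIn_contraMapBounded_iff F, neg_neg, neg_neg]
    exact hX
  refine ⟨Y' 0, ⟨-b, -a, hI T hT, Y', N', rfl, fun i => ?_⟩, eY 0⟩
  obtain ⟨h₁, h₂, h₃, h₄⟩ := h i
  obtain ⟨e⟩ := eY i
  obtain ⟨e'⟩ := eY (i + 1)
  obtain ⟨i⟩ := eN i
  exact ⟨(hasTriangle_contraMapBounded_iff F).1 (h₁.of_iso e i e'),
    (addClosure_contraMapBounded_iff F).1 (h₂.of_iso i),
    (leftPerp_contraMapBounded_iff F).1 (h₃.of_iso e), hI _ (h₄.of_iso e)⟩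

theorem nonnegShifts_contraMapBounded_iff :
    nonnegShifts (coAuslanderClass ((contraMapBounded F).obj (op T)))
      ((contraMapBounded F).obj (op X)) ↔ nonposShifts (auslanderClass T) X := by
  constructor
  · rintro ⟨n, W, hn, hW, ⟨e⟩⟩
    obtain ⟨Z, hZ, ⟨e'⟩⟩ := exists_auslanderClass_of_coAuslanderClass F hW
    obtain ⟨i⟩ := nonempty_contraMapBounded_shift_iso F Z (-n) n (by lia)
    exact ⟨-n, Z, by lia, hZ, ⟨((contraMapBounded F).preimageIso
      (e ≪≫ (shiftFunctor _ n).mapIso e' ≪≫ i.symm)).unop.symm⟩⟩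
  · rintro ⟨n, Z, hn, hZ, ⟨e⟩⟩
    obtain ⟨i⟩ := nonempty_contraMapBounded_shift_iso F Z n (-n) (by lia)
    exact ⟨-n, _, by lia, coAuslanderClass_contraMapBounded F hZ,
      ⟨(contraMapBounded F).mapIso e.symm.op ≪≫ i⟩⟩

/-- Hⁿ(Y) vanishes iff H⁻ⁿ(DY) does; the latter is tested by Hom(DX, DY[-n]), which vanishes iff
Hom(Y, X[-n]) does. -/
theorem CodetectsCohomology.of_contraMapBounded
    (h : DetectsCohomology ((contraMapBounded F).obj (op X))) : CodetectsCohomology X := by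
  intro Y n
  rw [← homVanishes_contraMapBounded_iff F, ← h,
    ← isZero_homologyFunctor_contraMapDerived_iff F Y.obj n (-n) (by lia)]
  rfl

theorem DetectsCohomology.of_iso {P P' : DerivedCategory.Bounded C} (h : DetectsCohomology P)
    (e : P ≅ P') : DetectsCohomology P' := fun X n =>
  (h X n).trans ⟨fun h' => h'.of_iso e (Iso.refl X), fun h' => h'.of_iso e.symm (Iso.refl X)⟩

theorem nonnegShifts.of_iso {P : ObjectProperty (DerivedCategory.Bounded C)}
    (h : nonnegShifts P X) (e : X ≅ Y) : nonnegShifts P Y := by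
  obtain ⟨n, Z, hn, hZ, ⟨i⟩⟩ := h
  exact ⟨n, Z, hn, hZ, ⟨e.symm ≪≫ i⟩⟩

end AuslanderTransport

/-! ### The module `DR` and the main theorem. -/

section

variable (k R : Type u) [CommRing k] [Ring R] [Algebra k R] [IsArtinAlgebra k R]
  [HasDerivedCategory.{w} (FGModuleCat.{u} R)] [HasDerivedCategory.{w'} (FGModuleCat.{u} Rᵐᵒᵖ)]

theorem nonempty_derivedDual_stalk_dualRegular_iso :
    Nonempty ((derivedDual k R).obj (op (stalk (dualRegular k R))) ≅
      stalk (FGModuleCat.of Rᵐᵒᵖ Rᵐᵒᵖ)) := by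
  obtain ⟨e⟩ := nonempty_contraMapBounded_stalk_iso
    (dualFunctor (AlgEquiv.refl : Rᵐᵒᵖ ≃ₐ[k] Rᵐᵒᵖ)) (dualRegular k R)
  exact ⟨e ≪≫ ObjectProperty.isoMk _
    ((DerivedCategory.singleFunctor _ 0).mapIso (dualDualRegularIso k R))⟩

theorem codetectsCohomology_dualRegular :
    CodetectsCohomology (stalk (dualRegular k R)) := by
  obtain ⟨e⟩ := nonempty_derivedDual_stalk_dualRegular_iso k R
  exact CodetectsCohomology.of_contraMapBounded (dualFunctor (AlgEquiv.refl : Rᵐᵒᵖ ≃ₐ[k] Rᵐᵒᵖ))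
    (DetectsCohomology.of_iso detectsCohomology_regular e.symm)

end

end WakamatsuSilting

theorem theorem3p8 (k R : Type u) [CommRing k] [Ring R] [Algebra k R] [IsArtinAlgebra k R]
    [HasDerivedCategory.{w} (FGModuleCat.{u} R)]
    [HasDerivedCategory.{w'} (FGModuleCat.{u} Rᵐᵒᵖ)]
    (T : DerivedCategory.Bounded (FGModuleCat.{u} R)) :
    List.TFAE [
      IsWakamatsuSilting R T,
      IsSemiSelforthogonal T ∧ nonposShifts (auslanderClass T) (stalk (dualRegular k R)),
      IsWakamatsuSilting Rᵐᵒᵖ ((derivedDual k R).obj (Opposite.op T))] := by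
  have hP := detectsCohomology_regular (A := R)
  have hJ := codetectsCohomology_dualRegular k R
  tfae_have 1 → 2 := fun ⟨hT, h⟩ =>
    ⟨hT, nonposShifts_auslanderClass_of_nonnegShifts_coAuslanderClass hP hJ
      (exists_isRightApproximation_fgModuleCat k R T) hT h⟩
  tfae_have 2 → 1 := fun ⟨hT, h⟩ =>
    ⟨hT, nonnegShifts_coAuslanderClass_of_nonposShifts_auslanderClass hP hJ
      (exists_isLeftApproximation_fgModuleCat k R T) hT h⟩
  -- Condition 2 for `T` is transported by the duality into condition 3, with D(DR) replaced by the
  -- regular module along `e`.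
  tfae_have 2 ↔ 3 := by
    obtain ⟨e⟩ := nonempty_derivedDual_stalk_dualRegular_iso k R
    let F := dualFunctor (R := R) (AlgEquiv.refl : Rᵐᵒᵖ ≃ₐ[k] Rᵐᵒᵖ)
    refine and_congr (isSemiSelforthogonal_contraMapBounded_iff F).symm
      ((nonnegShifts_contraMapBounded_iff F).symm.trans ?_)
    exact ⟨fun h => nonnegShifts.of_iso h e, fun h => nonnegShifts.of_iso h e.symm⟩
  tfae_finish
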